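/- Let $\Delta_1=[-1,1]$ and $\Delta_2=[a,b]$ with real numbers $1<a<b$. For $\zeta\in\overline{\mathbb C}\setminus\Delta_1$ let $g_{\Delta_1}(\cdot,\zeta)$ be the Green function of the domain $\overline{\mathbb C}\setminus\Delta_1$ with singularity at $\zeta$. For a positive Borel measure $\mu$ supported on $\Delta_2$ put $$V^\mu(z)=\int\log\frac1{|z-\zeta|}\,d\mu(\zeta),\qquad G^\mu_{\Delta_1}(z)=\int g_{\Delta_1}(\zeta,z)\,d\mu(\zeta)$$ (with values in $(-\infty,+\infty]$). Then there exists a unique positive Borel measure $\lambda$ of total mass $1$ supported on $\Delta_2$ for which there is a real constant $\gamma$ such that $$V^{\lambda}(x)+G^{\lambda}_{\Delta_1}(x)+g_{\Delta_1}(x,\infty)=\gamma\qquad\text{for every }x\in\Delta_2 .$$ -/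

import Mathlib

open Filter Topology MeasureTheory Set
open scoped ENNReal

noncomputable section

/-- The inversion `w ↦ 1 / w` as a map from `ℂ` to the Riemann sphere `OnePoint ℂ`,
with `0 ↦ ∞`; it is the usual local coordinate at infinity. -/
def invChart (w : ℂ) : OnePoint ℂ :=
  if w = 0 then OnePoint.infty else ((w⁻¹ : ℂ) : OnePoint ℂ)

/-- Harmonicity of a real function on the Riemann sphere at (i.e. in a neighbourhood of) a point,
in the coordinate `z` at finite points and in the coordinate `1 / z` at infinity. -/
def SphereHarmonicAt (u : OnePoint ℂ → ℝ) : OnePoint ℂ → Prop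
  | none => InnerProductSpace.HarmonicAt (fun w : ℂ => u (invChart w)) 0
  | some z => InnerProductSpace.HarmonicAt (fun w : ℂ => u (w : OnePoint ℂ)) z

/-- The model logarithmic pole: `log (1 / |z - p|)` for a finite `p`, and `log |z|` for `p = ∞`
(values at `z = ∞` are only relevant outside neighbourhoods of `p` and are set to `0`,
and the value at `z = p` is never used). -/
def logPole : OnePoint ℂ → OnePoint ℂ → ℝ
  | none, some z => Real.log ‖z‖
  | some p, some z => Real.log (1 / ‖z - p‖)
  | _, none => 0

/-- `g` is the (classical) Green function of the domain `D` of the Riemann sphere with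
singularity at `p`: it is harmonic in `D` off `p`, it differs from the model logarithmic pole near
`p` by a function harmonic at `p`, and it has boundary values zero. -/
structure IsGreenFunction (D : Set (OnePoint ℂ)) (p : OnePoint ℂ) (g : OnePoint ℂ → ℝ) :
    Prop where
  harmonic : ∀ q ∈ D, q ≠ p → SphereHarmonicAt g q
  pole : ∃ h : OnePoint ℂ → ℝ, SphereHarmonicAt h p ∧
    ∀ᶠ q in 𝓝[≠] p, g q = logPole p q + h q
  boundary : ∀ x ∈ frontier D, Tendsto g (𝓝[D] x) (𝓝 0)

open Classical in
/-- The value `g_D(z, p)` at `z` of the Green function of `D` with singularity at `p`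
(it is `+∞` at `z = p`, and set to `0` outside `D`). -/
def greenFunction (D : Set (OnePoint ℂ)) (z p : OnePoint ℂ) : EReal :=
  if z = p then ⊤
  else if h : z ∈ D ∧ ∃ g, IsGreenFunction D p g then ((h.2.choose z : ℝ) : EReal)
  else 0

/-- The integral of an extended real function: integral of the positive part minus integral of
the negative part. -/
def extIntegral {α : Type*} [MeasurableSpace α] (μ : Measure α) (f : α → EReal) : EReal :=
  ((∫⁻ x, (f x).toENNReal ∂μ : ℝ≥0∞) : EReal) - ((∫⁻ x, (-f x).toENNReal ∂μ : ℝ≥0∞) : EReal)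

/-- The logarithmic kernel `log (1 / |z - ζ|)`, equal to `+∞` on the diagonal. -/
def logKernel (z ζ : ℂ) : EReal :=
  if z = ζ then ⊤ else ((Real.log (1 / ‖z - ζ‖) : ℝ) : EReal)

/-- The logarithmic potential `V^μ(z) = ∫ log (1 / |z - ζ|) dμ(ζ)`. -/
def logPotential (μ : Measure ℂ) (z : ℂ) : EReal :=
  extIntegral μ (fun ζ => logKernel z ζ)

/-- The domain `D_K`, the complement of `K ⊆ ℂ` in the Riemann sphere. -/
def sphereCompl (K : Set ℂ) : Set (OnePoint ℂ) :=
  ((fun z : ℂ => (z : OnePoint ℂ)) '' K)ᶜ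

/-- The Green potential `G^μ_K(z) = ∫ g_K(ζ, z) dμ(ζ)`, where `g_K` is the Green function of the
complement of `K` in the Riemann sphere. -/
def greenPotential (K : Set ℂ) (μ : Measure ℂ) (z : ℂ) : EReal :=
  extIntegral μ (fun ζ => greenFunction (sphereCompl K) (ζ : OnePoint ℂ) (z : OnePoint ℂ))

/-- The interval `[c, d]` of the real line, as a subset of the complex plane. -/
def realInterval (c d : ℝ) : Set ℂ := (fun x : ℝ => (x : ℂ)) '' Set.Icc c d

/-- The class `M₁(K)` of positive Borel measures of total mass one supported on
the closed set `K`. -/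
def unitMeasures (K : Set ℂ) : Set (Measure ℂ) := {μ | μ univ = 1 ∧ μ Kᶜ = 0}

end

/-!
The Joukowski map `J s = (s + 1 / s) / 2` carries `0 < s < 1` onto `x > 1`. In the coordinate `s`
the Green function of the exterior of `[-1, 1]` is that of the unit disc, so
`g (J t) (J s) = log (1 - s t) - log |s - t|` and `g (J s) ∞ = -log s`. On the other hand
`|J s - J t| = |s - t| (1 - s t) / (2 s t)`. The factors `1 - s t` cancel, and so does `log s`:
if `σ` is the image of `λ` in the coordinate `s`, then at `x = J s`
`V + G + g = log 2 + ∫ log t dσ(t) - 2 ∫ log |s - t| dσ(t)`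
(`totalPotential_eq`). The problem thus becomes that of a probability measure `σ` on an interval
`[c, d]` with `0 < c < d < 1` whose logarithmic potential is constant on all of `[c, d]`.

Existence: the arcsine distribution has this property, because
`|e^{iθ} - e^{iα}| |e^{iθ} - e^{-iα}| = 2 |cos θ - cos α|` and the circle average of
`log |z - e^{iα}|` vanishes (`integrable_and_integral_log_arcsineMeasure`).

Uniqueness: for `|w| < 1` the Möbius map `y ↦ y / (1 + w y)` takes the arcsine distribution of
another interval to a measure `ρ` on `[c, d]` with potential
`∫ log |s - t| dρ(s) = C + log (1 - w t)`, which is the balayage of the point mass at `1 / w`.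
Integrating the constant potential of `σ` against `ρ` and exchanging the integrals shows that
`∫ log (1 - w t) dσ(t)` does not depend on `σ` (`exists_integral_log_one_sub_mul_eq`). The Taylor
coefficients in `w` are, up to the factors `-1 / n`, the moments of `σ`, and these determine `σ`
(`IsLogEquilibrium.unique`).

Since the Green function is only specified by its defining properties, its explicit form needs an
existence part (`isGreenFunction_intervalGreen_coe`, `isGreenFunction_intervalGreen_infty`) and a
uniqueness part (`IsGreenFunction.le`), the latter by the maximum principle on the sphere.
-/

noncomputable section

/-! ### The maximum principle on the sphere and uniqueness of Green functions -/

/-- Strong maximum principle for harmonic functions: with `f = Re F` near `z`, the maximum modulus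
principle applies to `exp F`. -/
theorem eventually_eq_of_harmonicAt_of_isLocalMax {f : ℂ → ℝ} {z : ℂ}
    (hf : InnerProductSpace.HarmonicAt f z) (hm : IsLocalMax f z) :
    ∀ᶠ y in 𝓝 z, f y = f z := by
  obtain ⟨ε, hε, hball⟩ := Metric.isOpen_iff.1
    (InnerProductSpace.isOpen_setOfPred_harmonicAt (f := f)) z hf
  obtain ⟨F, hF, hre⟩ := InnerProductSpace.HarmonicOnNhd.exists_analyticOnNhd_ball_re_eq
    (fun _ hy ↦ hball hy)
  have hnear : ∀ᶠ y in 𝓝 z, (F y).re = f y :=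
    eventually_of_mem (Metric.ball_mem_nhds z hε) fun y hy ↦ hre hy
  have hnorm : ∀ y, ‖Complex.exp (F y)‖ = Real.exp (F y).re := fun y ↦ Complex.norm_exp _
  have hdiff : ∀ᶠ y in 𝓝 z, DifferentiableAt ℂ (fun y ↦ Complex.exp (F y)) y :=
    eventually_of_mem (Metric.ball_mem_nhds z hε) fun y hy ↦ (hF y hy).differentiableAt.cexp
  have hmax : IsLocalMax (norm ∘ fun y ↦ Complex.exp (F y)) z := by
    filter_upwards [hm, hnear] with y hy hy'
    simp only [Function.comp, hnorm]
    rw [hy', hnear.self_of_nhds]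
    exact Real.exp_le_exp.2 hy
  filter_upwards [Complex.eventually_eq_of_isLocalMax_norm hdiff hmax, hnear] with y hy hy'
  have := congrArg norm hy
  simp only [hnorm] at this
  rw [← hy', ← hnear.self_of_nhds]
  exact Real.exp_injective this

/-- Properties near infinity may be checked in the coordinate `1 / z`. -/
theorem eventually_nhds_infty_of_invChart {P : OnePoint ℂ → Prop}
    (h : ∀ᶠ w in 𝓝 (0 : ℂ), P (invChart w)) : ∀ᶠ q in 𝓝 (OnePoint.infty : OnePoint ℂ), P q := by
  rw [OnePoint.nhds_infty_eq, eventually_sup]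
  constructor
  · rw [eventually_map, Filter.coclosedCompact_eq_cocompact, ← Metric.cobounded_eq_cocompact]
    have h1 : ∀ᶠ z in Bornology.cobounded ℂ, P (invChart z⁻¹) := tendsto_inv₀_cobounded.eventually h
    filter_upwards [h1, Bornology.eventually_ne_cobounded 0] with z hz hz0
    simpa [invChart, hz0] using hz
  · have := h.self_of_nhds
    simpa [invChart] using this

theorem continuousAt_invChart_zero : ContinuousAt invChart 0 := by
  have h0 : invChart 0 = OnePoint.infty := by simp [invChart]
  unfold ContinuousAt
  rw [h0, ← nhdsNE_sup_pure, tendsto_sup]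
  constructor
  · have h1 : Tendsto (fun w : ℂ ↦ ((w⁻¹ : ℂ) : OnePoint ℂ)) (𝓝[≠] 0) (𝓝 OnePoint.infty) := by
      refine OnePoint.tendsto_coe_infty.comp ?_
      rw [Filter.coclosedCompact_eq_cocompact, ← Metric.cobounded_eq_cocompact]
      exact tendsto_inv₀_nhdsNE_zero
    refine h1.congr' ?_
    filter_upwards [self_mem_nhdsWithin] with w hw
    have : w ≠ 0 := hw
    simp [invChart, this]
  · rw [tendsto_pure_left]
    intro s hs
    rw [h0]
    exact mem_of_mem_nhds hs

theorem SphereHarmonicAt.continuousAt {u : OnePoint ℂ → ℝ} {q : OnePoint ℂ}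
    (h : SphereHarmonicAt u q) : ContinuousAt u q := by
  induction q using OnePoint.rec with
  | infty =>
    have hc : ContinuousAt (fun w : ℂ => u (invChart w)) 0 := h.1.continuousAt
    have h0 : invChart 0 = OnePoint.infty := by simp [invChart]
    intro s hs
    have hs' : ∀ᶠ w in 𝓝 (0 : ℂ), u (invChart w) ∈ s := hc (by simpa only [h0] using hs)
    exact eventually_nhds_infty_of_invChart hs'
  | coe z =>
    exact OnePoint.continuousAt_coe.2 h.1.continuousAt

theorem SphereHarmonicAt.eventually_eq_of_isMax {u : OnePoint ℂ → ℝ} {q : OnePoint ℂ}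
    (h : SphereHarmonicAt u q) (hm : ∀ q', u q' ≤ u q) : ∀ᶠ q' in 𝓝 q, u q' = u q := by
  induction q using OnePoint.rec with
  | infty =>
    have h0 : invChart 0 = OnePoint.infty := by simp [invChart]
    refine eventually_nhds_infty_of_invChart ?_
    have := eventually_eq_of_harmonicAt_of_isLocalMax
      (f := fun w : ℂ => u (invChart w)) h (Eventually.of_forall fun w ↦ by simpa [h0] using hm _)
    simpa [h0] using this
  | coe z =>
    rw [OnePoint.nhds_coe_eq, eventually_map]
    exact eventually_eq_of_harmonicAt_of_isLocalMax
      (f := fun w : ℂ => u w) h (Eventually.of_forall fun w ↦ hm _)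

theorem SphereHarmonicAt.congr {u v : OnePoint ℂ → ℝ} {q : OnePoint ℂ}
    (h : SphereHarmonicAt u q) (huv : u =ᶠ[𝓝 q] v) : SphereHarmonicAt v q := by
  induction q using OnePoint.rec with
  | infty =>
    have h0 : invChart 0 = OnePoint.infty := by simp [invChart]
    have hc := continuousAt_invChart_zero
    unfold ContinuousAt at hc
    rw [h0] at hc
    exact (InnerProductSpace.harmonicAt_congr_nhds (f₁ := fun w : ℂ ↦ u (invChart w))
      (f₂ := fun w : ℂ ↦ v (invChart w)) (hc.eventually (Filter.eventually_iff.1 huv))).1 h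
  | coe z =>
    rw [OnePoint.nhds_coe_eq] at huv
    exact (InnerProductSpace.harmonicAt_congr_nhds (f₁ := fun w : ℂ ↦ u w)
      (f₂ := fun w : ℂ ↦ v w) (eventually_map.1 huv)).1 h

theorem SphereHarmonicAt.sub {u v : OnePoint ℂ → ℝ} {q : OnePoint ℂ}
    (hu : SphereHarmonicAt u q) (hv : SphereHarmonicAt v q) : SphereHarmonicAt (u - v) q := by
  induction q using OnePoint.rec with
  | infty => exact InnerProductSpace.HarmonicAt.sub hu hv
  | coe z => exact InnerProductSpace.HarmonicAt.sub hu hv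

/-- The maximum principle on a domain with boundary values zero. The extension of `u` by zero is
continuous on the compact connected sphere, and the set where it attains a positive maximum would
be open and closed. The boundary of `D` is assumed to be its whole complement, which holds for the
exterior of an interval and makes the extension continuous. -/
theorem sphere_maximum_principle {D : Set (OnePoint ℂ)} (hD : IsOpen D) (hDne : Dᶜ.Nonempty)
    (hDf : Dᶜ ⊆ frontier D) {u : OnePoint ℂ → ℝ} (hu : ∀ q ∈ D, SphereHarmonicAt u q)
    (hb : ∀ x ∈ frontier D, Tendsto u (𝓝[D] x) (𝓝 0)) : ∀ q ∈ D, u q ≤ 0 := by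
  classical
  set v : OnePoint ℂ → ℝ := fun q ↦ if q ∈ D then u q else 0 with hv
  have hvu : ∀ q ∈ D, v =ᶠ[𝓝 q] u := fun q hq ↦ by
    filter_upwards [hD.mem_nhds hq] with y hy
    simp [hv, hy]
  have hvh : ∀ q ∈ D, SphereHarmonicAt v q := fun q hq ↦ (hu q hq).congr (hvu q hq).symm
  have hcont : Continuous v := by
    rw [continuous_iff_continuousAt]
    intro q
    by_cases hq : q ∈ D
    · exact (hvh q hq).continuousAt
    · have hvq : v q = 0 := by simp [hv, hq]
      unfold ContinuousAt
      rw [hvq, ← nhdsWithin_univ, ← union_compl_self D, nhdsWithin_union, tendsto_sup]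
      constructor
      · refine (hb q (hDf hq)).congr' ?_
        filter_upwards [self_mem_nhdsWithin] with y hy
        simp [hv, hy]
      · refine tendsto_const_nhds.congr' ?_
        filter_upwards [self_mem_nhdsWithin] with y hy
        have : y ∉ D := hy
        simp [hv, this]
  obtain ⟨q₀, -, hmax⟩ := isCompact_univ.exists_isMaxOn (univ_nonempty (α := OnePoint ℂ))
    hcont.continuousOn
  have hmax' : ∀ q, v q ≤ v q₀ := fun q ↦ hmax (mem_univ q)
  have hle : v q₀ ≤ 0 := by
    by_contra! hpos
    have hclopen : IsClopen {q | v q = v q₀} := by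
      refine ⟨isClosed_eq hcont continuous_const, isOpen_iff_mem_nhds.2 fun q hq ↦ ?_⟩
      have hqD : q ∈ D := by
        by_contra hqD
        have h1 : v q = v q₀ := hq
        have h2 : v q = 0 := by simp [hv, hqD]
        linarith
      have h1 : v q = v q₀ := hq
      have := (hvh q hqD).eventually_eq_of_isMax (by simpa [h1] using hmax')
      rw [h1] at this
      exact this
    have huniv := hclopen.eq_univ ⟨q₀, rfl⟩
    obtain ⟨x, hx⟩ := hDne
    have h1 : x ∈ {q | v q = v q₀} := huniv ▸ mem_univ x
    rw [mem_ofPred_eq] at h1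
    have h2 : v x = 0 := by
      have : x ∉ D := hx
      simp [hv, this]
    linarith
  intro q hq
  have := hmax' q
  simp only [hv, hq, if_true] at this
  exact this.trans hle

/-- Two Green functions with the same pole are comparable off the pole; by symmetry they agree. -/
theorem IsGreenFunction.le {D : Set (OnePoint ℂ)} (hD : IsOpen D) (hDne : Dᶜ.Nonempty)
    (hDf : Dᶜ ⊆ frontier D) {p : OnePoint ℂ} (hp : p ∈ D) {g₁ g₂ : OnePoint ℂ → ℝ}
    (h₁ : IsGreenFunction D p g₁) (h₂ : IsGreenFunction D p g₂) {q : OnePoint ℂ} (hq : q ∈ D)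
    (hqp : q ≠ p) : g₁ q ≤ g₂ q := by
  classical
  obtain ⟨k₁, hk₁, hg₁⟩ := h₁.pole
  obtain ⟨k₂, hk₂, hg₂⟩ := h₂.pole
  -- The logarithmic poles cancel, so the difference extends harmonically across `p`.
  set u : OnePoint ℂ → ℝ := Function.update (g₁ - g₂) p (k₁ p - k₂ p) with hudef
  have hne : ∀ y, y ≠ p → u y = g₁ y - g₂ y := fun y hy ↦ by simp [hudef, hy]
  have hoff : ∀ x, x ≠ p → ∀ᶠ y in 𝓝 x, y ≠ p := fun x hx ↦ isOpen_ne.mem_nhds hx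
  have key : ∀ y ∈ D, u y ≤ 0 := by
    refine sphere_maximum_principle hD hDne hDf (fun y hy ↦ ?_) (fun x hx ↦ ?_)
    · by_cases hyp : y = p
      · subst hyp
        refine (hk₁.sub hk₂).congr ?_
        have hpunct : ∀ᶠ x in 𝓝[≠] y, (k₁ - k₂) x = u x := by
          filter_upwards [hg₁, hg₂, self_mem_nhdsWithin] with x hx1 hx2 hx
          rw [hne x hx, hx1, hx2]
          simp
        rw [EventuallyEq, ← nhdsNE_sup_pure, eventually_sup]
        exact ⟨hpunct, by simp [hudef]⟩
      · refine ((h₁.harmonic y hy hyp).sub (h₂.harmonic y hy hyp)).congr ?_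
        filter_upwards [hoff y hyp] with x hx
        simp [hne x hx]
    · have hxD : x ∉ D := by
        rw [hD.frontier_eq] at hx
        exact hx.2
      have hxp : x ≠ p := fun h ↦ hxD (h ▸ hp)
      have h0 := (h₁.boundary x hx).sub (h₂.boundary x hx)
      rw [sub_zero] at h0
      refine h0.congr' ?_
      filter_upwards [nhdsWithin_le_nhds (hoff x hxp)] with y hy
      rw [hne y hy]
  have := key q hq
  rw [hne q hqp] at this
  linarith

theorem greenFunction_eq {D : Set (OnePoint ℂ)} (hD : IsOpen D) (hDne : Dᶜ.Nonempty)
    (hDf : Dᶜ ⊆ frontier D) {p : OnePoint ℂ} (hp : p ∈ D) {g : OnePoint ℂ → ℝ}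
    (hg : IsGreenFunction D p g) {q : OnePoint ℂ} (hq : q ∈ D) (hqp : q ≠ p) :
    greenFunction D q p = ((g q : ℝ) : EReal) := by
  have h : q ∈ D ∧ ∃ g, IsGreenFunction D p g := ⟨hq, g, hg⟩
  rw [greenFunction, if_neg hqp, dif_pos h]
  have hc := h.2.choose_spec
  rw [le_antisymm (hc.le hD hDne hDf hp hg hq hqp) (hg.le hD hDne hDf hp hc hq hqp)]

/-! ### The complement of a real interval in the sphere -/

theorem mem_realInterval {c d : ℝ} {z : ℂ} :
    z ∈ realInterval c d ↔ z.im = 0 ∧ c ≤ z.re ∧ z.re ≤ d := by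
  constructor
  · rintro ⟨x, hx, rfl⟩
    simpa using hx
  · rintro ⟨h0, h1⟩
    exact ⟨z.re, h1, Complex.ext (by simp) (by simp [h0])⟩

theorem isCompact_realInterval (c d : ℝ) : IsCompact (realInterval c d) :=
  isCompact_Icc.image Complex.continuous_ofReal

theorem isOpen_sphereCompl {K : Set ℂ} (hK : IsCompact K) : IsOpen (sphereCompl K) :=
  OnePoint.isOpen_compl_image_coe.2 ⟨hK.isClosed, hK⟩

theorem coe_mem_sphereCompl {K : Set ℂ} {z : ℂ} : (z : OnePoint ℂ) ∈ sphereCompl K ↔ z ∉ K := by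
  simp [sphereCompl]

theorem infty_mem_sphereCompl {K : Set ℂ} : OnePoint.infty ∈ sphereCompl K :=
  OnePoint.infty_notMem_image_coe

theorem compl_sphereCompl_subset_frontier (c d : ℝ) :
    (sphereCompl (realInterval c d))ᶜ ⊆ frontier (sphereCompl (realInterval c d)) := by
  intro q hq
  rw [(isOpen_sphereCompl (isCompact_realInterval c d)).frontier_eq]
  refine ⟨?_, hq⟩
  induction q using OnePoint.rec with
  | infty => exact absurd infty_mem_sphereCompl hq
  | coe z =>
    have hz : z ∈ realInterval c d := by
      by_contra h
      exact hq (coe_mem_sphereCompl.2 h)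
    have hcl : z ∈ closure (realInterval c d)ᶜ := by
      rw [Metric.mem_closure_iff]
      intro ε hε
      refine ⟨z + (ε / 2 : ℝ) * Complex.I, fun h ↦ ?_, ?_⟩
      · have h1 := (mem_realInterval.1 h).1
        have h2 := (mem_realInterval.1 hz).1
        simp [h2] at h1
        exact hε.ne' h1
      · rw [dist_eq_norm]
        simp [abs_of_pos hε]
        exact hε
    have h := image_closure_subset_closure_image OnePoint.continuous_coe (mem_image_of_mem _ hcl)
    refine closure_mono ?_ h
    rintro _ ⟨y, hy, rfl⟩
    exact coe_mem_sphereCompl.2 hy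

/-! ### The Green function of the exterior of `[-1, 1]` -/

/-- The principal square root; it has positive real part off the negative real axis. -/
def principalSqrt (u : ℂ) : ℂ := Complex.exp (Complex.log u / 2)

theorem principalSqrt_sq {u : ℂ} (hu : u ≠ 0) : principalSqrt u ^ 2 = u := by
  rw [principalSqrt, ← Complex.exp_nat_mul]
  push_cast
  rw [mul_div_cancel₀ _ two_ne_zero, Complex.exp_log hu]

theorem principalSqrt_re_pos {u : ℂ} (hu : u ∈ Complex.slitPlane) : 0 < (principalSqrt u).re := by
  rw [principalSqrt, Complex.exp_re]
  have h1 := Complex.neg_pi_lt_arg u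
  have h2 := Complex.arg_le_pi u
  have h3 := Complex.slitPlane_arg_ne_pi hu
  have h4 : u.arg < Real.pi := lt_of_le_of_ne h2 h3
  refine mul_pos (Real.exp_pos _) (Real.cos_pos_of_mem_Ioo ?_)
  have : (Complex.log u / 2).im = u.arg / 2 := by simp [Complex.log_im]
  rw [this]
  constructor <;> linarith

theorem analyticAt_principalSqrt {u : ℂ} (hu : u ∈ Complex.slitPlane) :
    AnalyticAt ℂ principalSqrt u :=
  ((analyticAt_clog hu).div analyticAt_const two_ne_zero).cexp

/-- The conformal map of the exterior of `[-1, 1]` onto the unit disc sending infinity to zero, in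
the coordinate `w = 1 / z`. -/
def discMap (w : ℂ) : ℂ := w / (1 + principalSqrt (1 - w ^ 2))

section discMap

variable {w : ℂ}

theorem one_add_principalSqrt_ne_zero (hw : 1 - w ^ 2 ∈ Complex.slitPlane) :
    1 + principalSqrt (1 - w ^ 2) ≠ 0 := by
  intro h
  have h1 := principalSqrt_re_pos hw
  have h2 := congrArg Complex.re h
  simp at h2
  linarith

theorem discMap_zero : discMap 0 = 0 := by simp [discMap]

theorem discMap_ne_zero (hw : 1 - w ^ 2 ∈ Complex.slitPlane) (h0 : w ≠ 0) : discMap w ≠ 0 :=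
  div_ne_zero h0 (one_add_principalSqrt_ne_zero hw)

theorem analyticAt_discMap (hw : 1 - w ^ 2 ∈ Complex.slitPlane) : AnalyticAt ℂ discMap w := by
  have h1 : AnalyticAt ℂ (fun w : ℂ ↦ 1 - w ^ 2) w := by fun_prop
  have h2 : AnalyticAt ℂ (fun w : ℂ ↦ principalSqrt (1 - w ^ 2)) w :=
    AnalyticAt.fun_comp (f := fun w : ℂ ↦ 1 - w ^ 2) (analyticAt_principalSqrt hw) h1
  exact analyticAt_id.div (analyticAt_const.add h2) (one_add_principalSqrt_ne_zero hw)

/-- `discMap` inverts the Joukowski map: `1 / w = (t + 1 / t) / 2` for `t = discMap w`. -/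
theorem discMap_equation (hw : 1 - w ^ 2 ∈ Complex.slitPlane) :
    w * (1 + discMap w ^ 2) = 2 * discMap w := by
  have h1 := one_add_principalSqrt_ne_zero hw
  have h2 := principalSqrt_sq (Complex.slitPlane_ne_zero hw)
  rw [discMap]
  field_simp
  linear_combination w * h2

/-- With `r = √(1 - w²)`, `|discMap w|² = |1 - r| / |1 + r| < 1` since `Re r > 0`. -/
theorem norm_discMap_lt_one (hw : 1 - w ^ 2 ∈ Complex.slitPlane) : ‖discMap w‖ < 1 := by
  have h1 := one_add_principalSqrt_ne_zero hw
  have h2 := principalSqrt_sq (Complex.slitPlane_ne_zero hw)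
  have h3 := principalSqrt_re_pos hw
  set r := principalSqrt (1 - w ^ 2) with hr
  have hpos : 0 < ‖1 + r‖ := norm_pos_iff.2 h1
  have hlt : ‖1 - r‖ < ‖1 + r‖ := by
    rw [← sq_lt_sq₀ (norm_nonneg _) (norm_nonneg _), ← Complex.normSq_eq_norm_sq,
      ← Complex.normSq_eq_norm_sq, Complex.normSq_apply, Complex.normSq_apply]
    simp
    nlinarith
  have hsq : ‖w‖ ^ 2 = ‖1 - r‖ * ‖1 + r‖ := by
    rw [← norm_pow, ← norm_mul]
    congr 1
    linear_combination h2
  rw [discMap, norm_div, div_lt_one hpos, ← sq_lt_sq₀ (norm_nonneg _) hpos.le, hsq, sq]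
  exact mul_lt_mul_of_pos_right hlt hpos

/-- The roots of the quadratic equation for `discMap w` have product one, so only one of them lies
in the unit disc. -/
theorem eq_discMap (hw : 1 - w ^ 2 ∈ Complex.slitPlane) {t : ℂ} (ht : ‖t‖ < 1)
    (h : w * (1 + t ^ 2) = 2 * t) : t = discMap w := by
  have h1 := discMap_equation hw
  have h2 := norm_discMap_lt_one hw
  have h3 : (t - discMap w) * (1 - t * discMap w) = 0 := by
    linear_combination (-(1 + discMap w ^ 2) / 2) * h + ((1 + t ^ 2) / 2) * h1
  rcases mul_eq_zero.1 h3 with h4 | h4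
  · exact sub_eq_zero.1 h4
  · have h5 : ‖t * discMap w‖ < 1 := by
      rw [norm_mul]
      exact mul_lt_one_of_nonneg_of_lt_one_left (norm_nonneg _) ht h2.le
    rw [← sub_eq_zero.1 h4] at h5
    simp at h5

end discMap

theorem one_sub_inv_sq_mem_slitPlane {z : ℂ} (hz : z ∉ realInterval (-1) 1) :
    1 - z⁻¹ ^ 2 ∈ Complex.slitPlane := by
  by_contra h
  rw [Complex.mem_slitPlane_iff, not_or, not_lt, not_not] at h
  obtain ⟨h1, h2⟩ := h
  set w := z⁻¹ with hw
  simp [sq] at h1 h2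
  have him : w.im = 0 := by
    by_contra him
    have hre : w.re = 0 := by
      have : w.re * w.im = 0 := by linarith
      exact (mul_eq_zero.1 this).resolve_right him
    rw [hre] at h1
    nlinarith [mul_self_nonneg w.im]
  rw [him] at h1
  have hwre : w = (w.re : ℂ) := Complex.ext (by simp) (by simp [him])
  have hz' : z = ((w.re⁻¹ : ℝ) : ℂ) := by
    rw [← inv_inv z, ← hw, Complex.ofReal_inv, ← hwre]
  apply hz
  refine ⟨w.re⁻¹, ?_, hz'.symm⟩
  have habs : 1 ≤ |w.re| := by
    rw [← one_le_sq_iff_one_le_abs]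
    nlinarith
  have : |w.re⁻¹| ≤ 1 := by
    rw [abs_inv]
    exact inv_le_one_of_one_le₀ habs
  exact abs_le.1 this

theorem ne_zero_of_notMem_realInterval {z : ℂ} (hz : z ∉ realInterval (-1) 1) : z ≠ 0 := by
  rintro rfl
  exact hz (mem_realInterval.2 (by simp))

theorem discMap_inv_equation {z : ℂ} (hz : z ∉ realInterval (-1) 1) :
    1 + discMap z⁻¹ ^ 2 = 2 * z * discMap z⁻¹ := by
  have h0 := ne_zero_of_notMem_realInterval hz
  have h := discMap_equation (one_sub_inv_sq_mem_slitPlane hz)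
  linear_combination z * h - (1 + discMap z⁻¹ ^ 2) * mul_inv_cancel₀ h0

theorem analyticAt_discMap_inv {z : ℂ} (hz : z ∉ realInterval (-1) 1) :
    AnalyticAt ℂ (fun z ↦ discMap z⁻¹) z :=
  (analyticAt_discMap (one_sub_inv_sq_mem_slitPlane hz)).fun_comp
    (analyticAt_inv (ne_zero_of_notMem_realInterval hz))

theorem one_sub_mul_ne_zero {s : ℝ} (hs0 : 0 ≤ s) (hs1 : s < 1) {t : ℂ} (ht : ‖t‖ < 1) :
    1 - s * t ≠ 0 := by
  intro h
  have : ‖(s : ℂ) * t‖ < 1 := by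
    rw [norm_mul, Complex.norm_real, Real.norm_of_nonneg hs0]
    exact mul_lt_one_of_nonneg_of_lt_one_left hs0 hs1 ht.le
  rw [← sub_eq_zero.1 h] at this
  simp at this

/-- The Green function of the unit disc with pole at the real point `s`. -/
def discGreen (s : ℝ) (t : ℂ) : ℝ := Real.log ‖1 - s * t‖ - Real.log ‖t - s‖

theorem harmonicAt_discGreen_comp {s : ℝ} (hs0 : 0 ≤ s) (hs1 : s < 1) {f : ℂ → ℂ} {z : ℂ}
    (hf : AnalyticAt ℂ f z) (hf1 : ‖f z‖ < 1) (hfs : f z ≠ s) :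
    InnerProductSpace.HarmonicAt (fun y ↦ discGreen s (f y)) z := by
  have h1 : AnalyticAt ℂ (fun y ↦ 1 - s * f y) z := by fun_prop
  have h2 : AnalyticAt ℂ (fun y ↦ f y - s) z := by fun_prop
  exact (h1.harmonicAt_log_norm (one_sub_mul_ne_zero hs0 hs1 hf1)).sub
    (h2.harmonicAt_log_norm (sub_ne_zero.2 hfs))

theorem normSq_one_sub_mul (s : ℝ) (t : ℂ) :
    ‖1 - s * t‖ ^ 2 = ‖t - s‖ ^ 2 + (1 - s ^ 2) * (1 - ‖t‖ ^ 2) := by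
  simp only [← Complex.normSq_eq_norm_sq, Complex.normSq_apply]
  simp
  ring

theorem discGreen_nonneg {s : ℝ} (hs0 : 0 ≤ s) (hs1 : s < 1) {t : ℂ} (ht : ‖t‖ < 1)
    (hts : t ≠ s) : 0 ≤ discGreen s t := by
  have hB : 0 < ‖t - s‖ := norm_pos_iff.2 (sub_ne_zero.2 hts)
  have hsq := normSq_one_sub_mul s t
  have hle : ‖t - s‖ ≤ ‖1 - s * t‖ := by
    rw [← sq_le_sq₀ (norm_nonneg _) (norm_nonneg _), hsq]
    have : 0 ≤ (1 - s ^ 2) * (1 - ‖t‖ ^ 2) := by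
      apply mul_nonneg <;> nlinarith [norm_nonneg t]
    linarith
  exact sub_nonneg.2 (Real.log_le_log hB hle)

/-- Quantitative decay of the disc Green function at the unit circle. -/
theorem discGreen_le {s : ℝ} (hs0 : 0 ≤ s) (hs1 : s < 1) {t : ℂ} (ht : ‖t‖ < 1)
    (hts : s < ‖t‖) : discGreen s t ≤ (1 - s ^ 2) * (1 - ‖t‖ ^ 2) / (‖t‖ - s) ^ 2 := by
  have hBs : ‖t‖ - s ≤ ‖t - s‖ := by
    have := norm_sub_norm_le t (s : ℂ)
    rwa [Complex.norm_real, Real.norm_of_nonneg hs0] at this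
  have hd : 0 < ‖t‖ - s := sub_pos.2 hts
  have hB : 0 < ‖t - s‖ := hd.trans_le hBs
  have hsq := normSq_one_sub_mul s t
  have hnn : 0 ≤ (1 - s ^ 2) * (1 - ‖t‖ ^ 2) := by
    apply mul_nonneg <;> nlinarith [norm_nonneg t]
  set E := (1 - s ^ 2) * (1 - ‖t‖ ^ 2)
  set A := ‖1 - s * t‖
  set B := ‖t - s‖
  have hA : 0 < A := norm_pos_iff.2 (one_sub_mul_ne_zero hs0 hs1 ht)
  calc discGreen s t = Real.log (A / B) := (Real.log_div hA.ne' hB.ne').symm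
    _ ≤ Real.log ((A / B) ^ 2) := by
        have h1 : 1 ≤ A / B := by
          rw [one_le_div hB, ← sq_le_sq₀ hB.le hA.le]
          linarith
        exact Real.log_le_log (by positivity) (by nlinarith)
    _ ≤ (A / B) ^ 2 - 1 := Real.log_le_sub_one_of_pos (by positivity)
    _ = E / B ^ 2 := by rw [div_pow, hsq]; field_simp; ring
    _ ≤ E / (‖t‖ - s) ^ 2 := by gcongr

/-- The preimage of the circle of radius `ρ` is the ellipse `|z - 1| + |z + 1| = ρ + 1 / ρ`. This
controls `|discMap (1 / z)|` near `[-1, 1]`, including the point `0`, where `1 / z` is unbounded. -/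
theorem norm_discMap_inv_ellipse {z : ℂ} (hz : z ∉ realInterval (-1) 1) :
    (‖z - 1‖ + ‖z + 1‖) * ‖discMap z⁻¹‖ = 1 + ‖discMap z⁻¹‖ ^ 2 := by
  have h := discMap_inv_equation hz
  set t := discMap z⁻¹
  have h1 : 2 * ‖z - 1‖ * ‖t‖ = ‖t - 1‖ ^ 2 := by
    rw [← norm_pow, ← Complex.norm_two, ← norm_mul, ← norm_mul]
    congr 1
    linear_combination -h
  have h2 : 2 * ‖z + 1‖ * ‖t‖ = ‖t + 1‖ ^ 2 := by
    rw [← norm_pow, ← Complex.norm_two, ← norm_mul, ← norm_mul]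
    congr 1
    linear_combination -h
  have h3 : ‖t - 1‖ ^ 2 + ‖t + 1‖ ^ 2 = 2 * (1 + ‖t‖ ^ 2) := by
    simp only [← Complex.normSq_eq_norm_sq, Complex.normSq_apply]
    simp
    ring
  linarith

theorem tendsto_norm_discMap_inv {x : ℂ} (hx : x ∈ realInterval (-1) 1) :
    Tendsto (fun z ↦ ‖discMap z⁻¹‖) (𝓝[(realInterval (-1) 1)ᶜ] x) (𝓝 1) := by
  have hfoci : ‖x - 1‖ + ‖x + 1‖ = 2 := by
    obtain ⟨y, hy, rfl⟩ := hx
    have h1 : ((y : ℂ) - 1) = ((y - 1 : ℝ) : ℂ) := by push_cast; ring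
    have h2 : ((y : ℂ) + 1) = ((y + 1 : ℝ) : ℂ) := by push_cast; ring
    rw [h1, h2, Complex.norm_real, Complex.norm_real, Real.norm_of_nonpos (by linarith [hy.2]),
      Real.norm_of_nonneg (by linarith [hy.1])]
    ring
  have hcont : Continuous fun z : ℂ ↦ 1 - √(‖z - 1‖ + ‖z + 1‖ - 2) := by fun_prop
  have hlow : Tendsto (fun z : ℂ ↦ 1 - √(‖z - 1‖ + ‖z + 1‖ - 2))
      (𝓝[(realInterval (-1) 1)ᶜ] x) (𝓝 1) := by
    have := (hcont.tendsto x).mono_left (nhdsWithin_le_nhds (s := (realInterval (-1) 1)ᶜ))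
    simpa [hfoci] using this
  refine tendsto_of_tendsto_of_tendsto_of_le_of_le' hlow tendsto_const_nhds ?_ ?_
  · filter_upwards [self_mem_nhdsWithin] with z hz
    have h1 := norm_discMap_inv_ellipse hz
    have h2 := norm_discMap_lt_one (one_sub_inv_sq_mem_slitPlane hz)
    have h3 := norm_nonneg (discMap z⁻¹)
    have h4 : 2 ≤ ‖z - 1‖ + ‖z + 1‖ := by
      have := norm_sub_le (z + 1) (z - 1)
      norm_num at this
      rwa [add_comm]
    have h5 : 1 - ‖discMap z⁻¹‖ ≤ √(‖z - 1‖ + ‖z + 1‖ - 2) := by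
      apply Real.le_sqrt_of_sq_le
      nlinarith
    linarith
  · filter_upwards [self_mem_nhdsWithin] with z hz
    exact (norm_discMap_lt_one (one_sub_inv_sq_mem_slitPlane hz)).le

theorem tendsto_discGreen_discMap_inv {s : ℝ} (hs0 : 0 ≤ s) (hs1 : s < 1) {x : ℂ}
    (hx : x ∈ realInterval (-1) 1) :
    Tendsto (fun z ↦ discGreen s (discMap z⁻¹)) (𝓝[(realInterval (-1) 1)ᶜ] x) (𝓝 0) := by
  have hρ := tendsto_norm_discMap_inv hx
  have hup : Tendsto (fun z ↦ (1 - s ^ 2) * (1 - ‖discMap z⁻¹‖ ^ 2) / (‖discMap z⁻¹‖ - s) ^ 2)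
      (𝓝[(realInterval (-1) 1)ᶜ] x) (𝓝 0) := by
    have h := ((tendsto_const_nhds (x := 1 - s ^ 2)).mul
      ((tendsto_const_nhds (x := (1 : ℝ))).sub (hρ.pow 2))).div ((hρ.sub_const s).pow 2)
      (pow_ne_zero 2 (sub_pos.2 hs1).ne')
    simpa [Pi.div_def] using h
  have hev : ∀ᶠ z in 𝓝[(realInterval (-1) 1)ᶜ] x, s < ‖discMap z⁻¹‖ := hρ.eventually_const_lt hs1
  refine tendsto_of_tendsto_of_tendsto_of_le_of_le' tendsto_const_nhds hup ?_ ?_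
  · filter_upwards [self_mem_nhdsWithin, hev] with z hz hz'
    refine discGreen_nonneg hs0 hs1 (norm_discMap_lt_one (one_sub_inv_sq_mem_slitPlane hz)) ?_
    intro h
    rw [h, Complex.norm_real, Real.norm_of_nonneg hs0] at hz'
    exact lt_irrefl _ hz'
  · filter_upwards [self_mem_nhdsWithin, hev] with z hz hz'
    exact discGreen_le hs0 hs1 (norm_discMap_lt_one (one_sub_inv_sq_mem_slitPlane hz)) hz'

/-- The Green function of the exterior of `[-1, 1]` with pole at the preimage of the point `s` of
the unit disc: `∞` for `s = 0`, and `(s + 1 / s) / 2` for `0 < s < 1`. -/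
def intervalGreen (s : ℝ) : OnePoint ℂ → ℝ
  | none => discGreen s (discMap 0)
  | some z => discGreen s (discMap z⁻¹)

theorem intervalGreen_invChart (s : ℝ) (w : ℂ) :
    intervalGreen s (invChart w) = discGreen s (discMap w) := by
  by_cases h : w = 0
  · subst h
    simp only [invChart, if_true]
    rfl
  · simp only [invChart, h, if_false]
    change discGreen s (discMap w⁻¹⁻¹) = _
    rw [inv_inv]

theorem one_sub_zero_sq_mem_slitPlane : 1 - (0 : ℂ) ^ 2 ∈ Complex.slitPlane := by simp

theorem sphereHarmonicAt_intervalGreen_infty {s : ℝ} (hs0 : 0 < s) (hs1 : s < 1) :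
    SphereHarmonicAt (intervalGreen s) OnePoint.infty := by
  change InnerProductSpace.HarmonicAt (fun w : ℂ => intervalGreen s (invChart w)) 0
  simp only [intervalGreen_invChart]
  refine harmonicAt_discGreen_comp hs0.le hs1 (analyticAt_discMap one_sub_zero_sq_mem_slitPlane)
    (norm_discMap_lt_one one_sub_zero_sq_mem_slitPlane) ?_
  rw [discMap_zero]
  exact_mod_cast hs0.ne

theorem sphereHarmonicAt_intervalGreen_coe {s : ℝ} (hs0 : 0 ≤ s) (hs1 : s < 1) {z : ℂ}
    (hz : z ∉ realInterval (-1) 1) (hzs : discMap z⁻¹ ≠ s) :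
    SphereHarmonicAt (intervalGreen s) z :=
  harmonicAt_discGreen_comp (f := fun z ↦ discMap z⁻¹) hs0 hs1 (analyticAt_discMap_inv hz)
    (norm_discMap_lt_one (one_sub_inv_sq_mem_slitPlane hz)) hzs

theorem tendsto_intervalGreen_frontier {s : ℝ} (hs0 : 0 ≤ s) (hs1 : s < 1) {q : OnePoint ℂ}
    (hq : q ∈ frontier (sphereCompl (realInterval (-1) 1))) :
    Tendsto (intervalGreen s) (𝓝[sphereCompl (realInterval (-1) 1)] q) (𝓝 0) := by
  rw [(isOpen_sphereCompl (isCompact_realInterval _ _)).frontier_eq] at hq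
  induction q using OnePoint.rec with
  | infty => exact absurd infty_mem_sphereCompl hq.2
  | coe z =>
    have hz : z ∈ realInterval (-1) 1 := by
      by_contra h
      exact hq.2 (coe_mem_sphereCompl.2 h)
    rw [OnePoint.nhdsWithin_coe, tendsto_map'_iff]
    have : (fun z : ℂ ↦ (z : OnePoint ℂ)) ⁻¹' sphereCompl (realInterval (-1) 1)
        = (realInterval (-1) 1)ᶜ := by
      ext y
      exact coe_mem_sphereCompl
    rw [this]
    exact tendsto_discGreen_discMap_inv hs0 hs1 hz

theorem isGreenFunction_intervalGreen_infty :
    IsGreenFunction (sphereCompl (realInterval (-1) 1)) OnePoint.infty (intervalGreen 0) where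
  harmonic q hq hqp := by
    induction q using OnePoint.rec with
    | infty => exact absurd rfl hqp
    | coe z =>
      have hz := coe_mem_sphereCompl.1 hq
      refine sphereHarmonicAt_intervalGreen_coe le_rfl one_pos hz ?_
      rw [Complex.ofReal_zero]
      exact discMap_ne_zero (one_sub_inv_sq_mem_slitPlane hz)
        (inv_ne_zero (ne_zero_of_notMem_realInterval hz))
  pole := by
    -- `-log |Ψ(1/z)| = log |z| + log |1 + √(1 - z⁻²)|`, where `Ψ` is `discMap`
    set k : ℂ → ℝ := fun w ↦ Real.log ‖1 + principalSqrt (1 - w ^ 2)‖ with hk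
    refine ⟨fun q ↦ q.elim (k 0) fun z ↦ k z⁻¹, ?_, ?_⟩
    · change InnerProductSpace.HarmonicAt
        (fun w : ℂ => (invChart w).elim (k 0) fun z ↦ k z⁻¹) 0
      have : (fun w : ℂ => (invChart w).elim (k 0) fun z ↦ k z⁻¹) = k := by
        ext w
        by_cases h : w = 0
        · simp [invChart, h]
        · simp [invChart, h]
      rw [this]
      have h1 : AnalyticAt ℂ (fun w : ℂ ↦ 1 - w ^ 2) 0 := by fun_prop
      have h2 : AnalyticAt ℂ (fun w : ℂ ↦ 1 + principalSqrt (1 - w ^ 2)) 0 :=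
        analyticAt_const.add
          (AnalyticAt.fun_comp (f := fun w : ℂ ↦ 1 - w ^ 2)
            (analyticAt_principalSqrt one_sub_zero_sq_mem_slitPlane) h1)
      exact h2.harmonicAt_log_norm (one_add_principalSqrt_ne_zero one_sub_zero_sq_mem_slitPlane)
    · have hD : ∀ᶠ q in 𝓝[≠] (OnePoint.infty : OnePoint ℂ),
          q ∈ sphereCompl (realInterval (-1) 1) :=
        nhdsWithin_le_nhds ((isOpen_sphereCompl (isCompact_realInterval _ _)).mem_nhds
          infty_mem_sphereCompl)
      filter_upwards [hD, self_mem_nhdsWithin] with q hq hqp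
      induction q using OnePoint.rec with
      | infty => exact absurd rfl hqp
      | coe z =>
        have hz := coe_mem_sphereCompl.1 hq
        have hz0 := ne_zero_of_notMem_realInterval hz
        have hr := one_add_principalSqrt_ne_zero (one_sub_inv_sq_mem_slitPlane hz)
        change discGreen 0 (discMap z⁻¹) = Real.log ‖z‖ + k z⁻¹
        have h2 : ‖discMap z⁻¹‖ = (‖z‖ * ‖1 + principalSqrt (1 - z⁻¹ ^ 2)‖)⁻¹ := by
          rw [discMap, norm_div, norm_inv, mul_inv, div_eq_mul_inv]
        simp only [discGreen, Complex.ofReal_zero, zero_mul, sub_zero, norm_one, Real.log_one,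
          zero_sub, h2, hk]
        rw [Real.log_inv, neg_neg, Real.log_mul (norm_ne_zero_iff.2 hz0) (norm_ne_zero_iff.2 hr)]
  boundary _ hx := tendsto_intervalGreen_frontier le_rfl one_pos hx

/-- The Joukowski map `s ↦ (s + 1 / s) / 2`. -/
def joukowski (s : ℝ) : ℝ := (s + s⁻¹) / 2

theorem one_lt_joukowski {s : ℝ} (hs0 : 0 < s) (hs1 : s < 1) : 1 < joukowski s := by
  have : joukowski s - 1 = (1 - s) ^ 2 / (2 * s) := by
    rw [joukowski]
    field_simp
    ring
  have h2 : 0 < (1 - s) ^ 2 / (2 * s) := by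
    have : 0 < 1 - s := by linarith
    positivity
  linarith

theorem ofReal_notMem_realInterval {x : ℝ} (hx : 1 < x) : (x : ℂ) ∉ realInterval (-1) 1 := by
  rw [mem_realInterval]
  simp
  intro
  exact hx

theorem discMap_joukowski {s : ℝ} (hs0 : 0 < s) (hs1 : s < 1) :
    discMap ((joukowski s : ℝ) : ℂ)⁻¹ = s := by
  have hJ := one_lt_joukowski hs0 hs1
  symm
  refine eq_discMap (one_sub_inv_sq_mem_slitPlane (ofReal_notMem_realInterval hJ)) ?_ ?_
  · rw [Complex.norm_real, Real.norm_of_nonneg hs0.le]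
    exact hs1
  · have hJ0 : joukowski s ≠ 0 := (one_pos.trans hJ).ne'
    have : (joukowski s)⁻¹ * (1 + s ^ 2) = 2 * s := by
      rw [inv_mul_eq_iff_eq_mul₀ hJ0, joukowski]
      field_simp
      ring
    exact_mod_cast this

theorem discMap_inv_ne {s : ℝ} (hs0 : 0 < s) (hs1 : s < 1) {z : ℂ} (hz : z ∉ realInterval (-1) 1)
    (hzp : z ≠ joukowski s) : discMap z⁻¹ ≠ s := by
  intro h
  apply hzp
  have h1 := discMap_inv_equation hz
  have h2 := discMap_inv_equation (ofReal_notMem_realInterval (one_lt_joukowski hs0 hs1))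
  rw [discMap_joukowski hs0 hs1] at h2
  rw [h, h2] at h1
  have hs : (2 * s : ℂ) ≠ 0 := by
    have : 2 * s ≠ 0 := by positivity
    exact_mod_cast this
  apply mul_right_cancel₀ hs
  linear_combination -h1

theorem isGreenFunction_intervalGreen_coe {s : ℝ} (hs0 : 0 < s) (hs1 : s < 1) :
    IsGreenFunction (sphereCompl (realInterval (-1) 1)) ((joukowski s : ℝ) : ℂ)
      (intervalGreen s) where
  harmonic q hq hqp := by
    induction q using OnePoint.rec with
    | infty => exact sphereHarmonicAt_intervalGreen_infty hs0 hs1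
    | coe z =>
      have hz := coe_mem_sphereCompl.1 hq
      refine sphereHarmonicAt_intervalGreen_coe hs0.le hs1 hz (discMap_inv_ne hs0 hs1 hz ?_)
      exact fun h ↦ hqp (congrArg _ h)
  pole := by
    -- `(z - p) · 2 s ψ = (ψ - s) (s ψ - 1)` for `ψ = Ψ(1/z)` and `p = (s + 1/s) / 2`
    set p : ℂ := ((joukowski s : ℝ) : ℂ) with hp
    have hpK : p ∉ realInterval (-1) 1 := ofReal_notMem_realInterval (one_lt_joukowski hs0 hs1)
    have hs0' : (s : ℂ) ≠ 0 := by exact_mod_cast hs0.ne'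
    set k : ℂ → ℝ := fun z ↦ Real.log ‖1 - s * discMap z⁻¹‖ + Real.log ‖1 - s * discMap z⁻¹‖
      - Real.log ‖2 * s * discMap z⁻¹‖ with hk
    refine ⟨fun q ↦ q.elim 0 k, ?_, ?_⟩
    · change InnerProductSpace.HarmonicAt k p
      have h0 := analyticAt_discMap_inv hpK
      have h1 : AnalyticAt ℂ (fun z : ℂ ↦ 1 - s * discMap z⁻¹) p :=
        analyticAt_const.sub (analyticAt_const.mul h0)
      have h2 : AnalyticAt ℂ (fun z : ℂ ↦ 2 * s * discMap z⁻¹) p := analyticAt_const.mul h0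
      have h3 := h1.harmonicAt_log_norm (one_sub_mul_ne_zero hs0.le hs1
        (norm_discMap_lt_one (one_sub_inv_sq_mem_slitPlane hpK)))
      refine (h3.add h3).sub (h2.harmonicAt_log_norm ?_)
      rw [discMap_joukowski hs0 hs1]
      simp [hs0']
    · have hD : ∀ᶠ q in 𝓝[≠] (p : OnePoint ℂ), q ∈ sphereCompl (realInterval (-1) 1) :=
        nhdsWithin_le_nhds ((isOpen_sphereCompl (isCompact_realInterval _ _)).mem_nhds
          (coe_mem_sphereCompl.2 hpK))
      have hfin : ∀ᶠ q in 𝓝[≠] (p : OnePoint ℂ), q ≠ OnePoint.infty :=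
        nhdsWithin_le_nhds (isOpen_ne.mem_nhds (OnePoint.coe_ne_infty p))
      filter_upwards [hD, hfin, self_mem_nhdsWithin] with q hq hq' hqp
      induction q using OnePoint.rec with
      | infty => exact absurd rfl hq'
      | coe z =>
        have hz := coe_mem_sphereCompl.1 hq
        have hzp : z ≠ p := fun h ↦ hqp (congrArg _ h)
        have hne := discMap_inv_ne hs0 hs1 hz hzp
        have hψ0 : discMap z⁻¹ ≠ 0 := discMap_ne_zero (one_sub_inv_sq_mem_slitPlane hz)
          (inv_ne_zero (ne_zero_of_notMem_realInterval hz))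
        have hψ1 := one_sub_mul_ne_zero hs0.le hs1
          (norm_discMap_lt_one (one_sub_inv_sq_mem_slitPlane hz))
        have e1 := discMap_inv_equation hz
        have e2 := discMap_inv_equation hpK
        rw [discMap_joukowski hs0 hs1] at e2
        change discGreen s (discMap z⁻¹) = Real.log (1 / ‖z - p‖) + k z
        simp only [discGreen, hk]
        set t := discMap z⁻¹
        have e3 : ‖z - p‖ * ‖2 * s * t‖ = ‖t - s‖ * ‖1 - s * t‖ := by
          rw [← norm_mul, ← norm_mul, ← norm_neg]
          congr 1
          linear_combination s * e1 - t * e2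
        have e4 := congrArg Real.log e3
        rw [Real.log_mul (norm_ne_zero_iff.2 (sub_ne_zero.2 hzp)) (by simp [hs0.ne', hψ0]),
          Real.log_mul (norm_ne_zero_iff.2 (sub_ne_zero.2 hne)) (norm_ne_zero_iff.2 hψ1)] at e4
        rw [one_div, Real.log_inv]
        linarith
  boundary _ hx := tendsto_intervalGreen_frontier hs0.le hs1 hx

theorem nonempty_compl_sphereCompl : (sphereCompl (realInterval (-1) 1))ᶜ.Nonempty :=
  ⟨((0 : ℂ) : OnePoint ℂ), fun h ↦ coe_mem_sphereCompl.1 h (mem_realInterval.2 (by simp))⟩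

theorem greenFunction_joukowski_infty {s : ℝ} (hs0 : 0 < s) (hs1 : s < 1) :
    greenFunction (sphereCompl (realInterval (-1) 1)) ((joukowski s : ℝ) : ℂ) OnePoint.infty
      = ((-Real.log s : ℝ) : EReal) := by
  rw [greenFunction_eq (isOpen_sphereCompl (isCompact_realInterval _ _))
    nonempty_compl_sphereCompl (compl_sphereCompl_subset_frontier _ _) infty_mem_sphereCompl
    isGreenFunction_intervalGreen_infty
    (coe_mem_sphereCompl.2 (ofReal_notMem_realInterval (one_lt_joukowski hs0 hs1)))
    (OnePoint.coe_ne_infty _)]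
  congr 1
  change discGreen 0 (discMap _) = _
  rw [discMap_joukowski hs0 hs1]
  simp [discGreen]

theorem greenFunction_joukowski_joukowski {s t : ℝ} (hs0 : 0 < s) (hs1 : s < 1) (ht0 : 0 < t)
    (ht1 : t < 1) (hne : joukowski t ≠ joukowski s) :
    greenFunction (sphereCompl (realInterval (-1) 1)) ((joukowski t : ℝ) : ℂ)
      ((joukowski s : ℝ) : ℂ) = ((Real.log (1 - s * t) - Real.log |s - t| : ℝ) : EReal) := by
  rw [greenFunction_eq (isOpen_sphereCompl (isCompact_realInterval _ _))
    nonempty_compl_sphereCompl (compl_sphereCompl_subset_frontier _ _)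
    (coe_mem_sphereCompl.2 (ofReal_notMem_realInterval (one_lt_joukowski hs0 hs1)))
    (isGreenFunction_intervalGreen_coe hs0 hs1)
    (coe_mem_sphereCompl.2 (ofReal_notMem_realInterval (one_lt_joukowski ht0 ht1)))]
  · congr 1
    change discGreen s (discMap _) = _
    rw [discMap_joukowski ht0 ht1, discGreen]
    congr 2
    · rw [← Complex.ofReal_mul, ← Complex.ofReal_one, ← Complex.ofReal_sub, Complex.norm_real,
        Real.norm_of_nonneg]
      nlinarith
    · rw [← Complex.ofReal_sub, Complex.norm_real, Real.norm_eq_abs, abs_sub_comm]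
  · intro h
    rw [OnePoint.coe_eq_coe] at h
    exact hne (Complex.ofReal_injective h)

/-! ### The arcsine distribution -/

/-- The arcsine distribution on `[c, d]`: the law of `(c + d) / 2 + (d - c) / 2 * cos θ` for a
uniformly distributed angle `θ`. -/
def arcsineMeasure (c d : ℝ) : Measure ℝ :=
  Measure.map (fun θ ↦ (c + d) / 2 + (d - c) / 2 * Real.cos θ)
    (ENNReal.ofReal (2 * Real.pi)⁻¹ • volume.restrict (Ioc 0 (2 * Real.pi)))

theorem measurable_arcsineParam (c d : ℝ) :
    Measurable fun θ ↦ (c + d) / 2 + (d - c) / 2 * Real.cos θ := by fun_prop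

instance isProbabilityMeasure_arcsineMeasure (c d : ℝ) :
    IsProbabilityMeasure (arcsineMeasure c d) := by
  constructor
  rw [arcsineMeasure, Measure.map_apply (measurable_arcsineParam c d) MeasurableSet.univ]
  simp only [preimage_univ, Measure.smul_apply, Measure.restrict_apply_univ, Real.volume_Ioc,
    sub_zero, smul_eq_mul]
  rw [← ENNReal.ofReal_mul (by positivity), inv_mul_cancel₀ (by positivity), ENNReal.ofReal_one]

theorem ae_arcsineMeasure_mem_Icc {c d : ℝ} (hcd : c < d) :
    ∀ᵐ t ∂arcsineMeasure c d, t ∈ Icc c d := by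
  rw [arcsineMeasure, ae_map_iff (p := (· ∈ Icc c d)) (measurable_arcsineParam c d).aemeasurable
    measurableSet_Icc]
  refine Eventually.of_forall fun θ ↦ ?_
  have h1 := Real.neg_one_le_cos θ
  have h2 := Real.cos_le_one θ
  constructor <;> nlinarith

theorem volume_setOf_cos_eq (y : ℝ) : volume {θ : ℝ | Real.cos θ = y} = 0 := by
  apply Set.Countable.measure_zero
  rcases eq_empty_or_nonempty {θ : ℝ | Real.cos θ = y} with h | ⟨α, hα⟩
  · rw [h]
    exact countable_empty
  · have hsub : {θ : ℝ | Real.cos θ = y} ⊆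
        (range fun k : ℤ ↦ 2 * k * Real.pi + α) ∪ range fun k : ℤ ↦ 2 * k * Real.pi - α := by
      intro θ hθ
      obtain ⟨k, hk | hk⟩ := Real.cos_eq_cos_iff.1 ((show Real.cos α = y from hα).trans
        (show Real.cos θ = y from hθ).symm)
      · exact Or.inl ⟨k, hk.symm⟩
      · exact Or.inr ⟨k, hk.symm⟩
    exact ((countable_range _).union (countable_range _)).mono hsub

theorem arcsineMeasure_singleton {c d : ℝ} (hcd : c < d) (t : ℝ) : arcsineMeasure c d {t} = 0 := by
  rw [arcsineMeasure, Measure.map_apply (measurable_arcsineParam c d) (measurableSet_singleton t),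
    Measure.smul_apply]
  have hsub : (fun θ ↦ (c + d) / 2 + (d - c) / 2 * Real.cos θ) ⁻¹' {t} ⊆
      {θ : ℝ | Real.cos θ = (t - (c + d) / 2) / ((d - c) / 2)} := by
    intro θ hθ
    have hθ' : (c + d) / 2 + (d - c) / 2 * Real.cos θ = t := hθ
    have : (d - c) / 2 ≠ 0 := by linarith
    rw [mem_ofPred_eq, eq_div_iff this]
    linarith
  rw [measure_mono_null hsub
    (nonpos_iff_eq_zero.1 ((Measure.restrict_apply_le _ _).trans (volume_setOf_cos_eq _).le)),
    smul_zero]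

theorem norm_circleMap_sub_mul_norm_circleMap_sub (α θ : ℝ) :
    ‖circleMap 0 1 θ - circleMap 0 1 α‖ * ‖circleMap 0 1 θ - circleMap 0 1 (-α)‖
      = 2 * |Real.cos α - Real.cos θ| := by
  have h1 : (circleMap 0 1 θ - circleMap 0 1 α) * (circleMap 0 1 θ - circleMap 0 1 (-α))
      = circleMap 0 1 θ * ((-(2 * (Real.cos α - Real.cos θ)) : ℝ) : ℂ) := by
    have e1 : Complex.exp (θ * Complex.I) * Complex.exp (-(θ * Complex.I)) = 1 := by
      rw [← Complex.exp_add]; simp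
    have e2 : Complex.exp (α * Complex.I) * Complex.exp (-(α * Complex.I)) = 1 := by
      rw [← Complex.exp_add]; simp
    simp only [circleMap, Complex.ofReal_one, one_mul, zero_add, Complex.ofReal_neg,
      Complex.ofReal_mul, Complex.ofReal_sub, Complex.ofReal_cos, Complex.cos, neg_mul,
      Complex.ofReal_ofNat]
    linear_combination e2 - e1
  rw [← norm_mul, h1, norm_mul, norm_circleMap_zero, Complex.norm_real, Real.norm_eq_abs, abs_neg,
    abs_mul]
  simp

theorem integrable_and_integral_log_arcsineMeasure {c d : ℝ} (hcd : c < d) {s : ℝ}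
    (hs : s ∈ Icc c d) : Integrable (fun t ↦ Real.log |s - t|) (arcsineMeasure c d) ∧
      ∫ t, Real.log |s - t| ∂arcsineMeasure c d = Real.log ((d - c) / 4) := by
  set α := Real.arccos ((s - (c + d) / 2) / ((d - c) / 2)) with hα
  have hr : 0 < (d - c) / 2 := by linarith
  have hcos : Real.cos α = (s - (c + d) / 2) / ((d - c) / 2) := by
    apply Real.cos_arccos
    · rw [le_div_iff₀ hr]; linarith [hs.1]
    · rw [div_le_iff₀ hr]; linarith [hs.2]
  have hs' : s = (c + d) / 2 + (d - c) / 2 * Real.cos α := by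
    rw [hcos, mul_div_cancel₀ _ hr.ne']; ring
  have hmeas : Measurable fun t ↦ Real.log |s - t| := by fun_prop
  set L : ℝ → ℝ → ℝ := fun β θ ↦ Real.log ‖circleMap 0 1 θ - circleMap 0 1 β‖ with hL
  have hLint : ∀ β, IntegrableOn (L β) (Ioc 0 (2 * Real.pi)) volume := fun β ↦
    (intervalIntegrable_iff_integrableOn_Ioc_of_le Real.two_pi_pos.le).1
      (circleIntegrable_log_norm_sub_const (a := circleMap 0 1 β) (c := 0) 1)
  have hL0 : ∀ β, ∫ θ in Ioc 0 (2 * Real.pi), L β θ = 0 := by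
    intro β
    have h := circleAverage_log_norm_sub_const₁ (a := circleMap 0 1 β) (by simp)
    rw [Real.circleAverage_def, smul_eq_mul, mul_eq_zero] at h
    have h' := h.resolve_left (by positivity)
    rwa [intervalIntegral.integral_of_le Real.two_pi_pos.le] at h'
  have hae : ∀ᵐ θ ∂volume.restrict (Ioc 0 (2 * Real.pi)),
      Real.log |s - ((c + d) / 2 + (d - c) / 2 * Real.cos θ)|
        = Real.log ((d - c) / 4) + (L α θ + L (-α) θ) := by
    have h0 : ∀ᵐ θ ∂(volume : Measure ℝ), Real.cos θ ≠ Real.cos α := by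
      rw [ae_iff]
      simpa using volume_setOf_cos_eq (Real.cos α)
    filter_upwards [ae_restrict_of_ae h0] with θ hθ
    have hprod := norm_circleMap_sub_mul_norm_circleMap_sub α θ
    have hpos : 0 < |Real.cos α - Real.cos θ| := abs_pos.2 (sub_ne_zero.2 hθ.symm)
    have hne : ‖circleMap 0 1 θ - circleMap 0 1 α‖ * ‖circleMap 0 1 θ - circleMap 0 1 (-α)‖
        ≠ 0 := by
      rw [hprod]; positivity
    simp only [hL]
    rw [← Real.log_mul (left_ne_zero_of_mul hne) (right_ne_zero_of_mul hne), hprod,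
      ← Real.log_mul (by linarith) (by positivity)]
    congr 1
    have : s - ((c + d) / 2 + (d - c) / 2 * Real.cos θ)
        = (d - c) / 2 * (Real.cos α - Real.cos θ) := by
      conv_lhs => rw [hs']
      ring
    rw [this, abs_mul, abs_of_pos hr]
    ring
  have hL2 : Integrable (fun θ ↦ L α θ + L (-α) θ) (volume.restrict (Ioc 0 (2 * Real.pi))) :=
    (hLint α).add (hLint (-α))
  have hsum : Integrable (fun θ ↦ Real.log ((d - c) / 4) + (L α θ + L (-α) θ))
      (volume.restrict (Ioc 0 (2 * Real.pi))) :=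
    (integrable_const _).add hL2
  constructor
  · rw [arcsineMeasure, integrable_map_measure hmeas.aestronglyMeasurable
      (measurable_arcsineParam c d).aemeasurable]
    refine Integrable.smul_measure ?_ ENNReal.ofReal_ne_top
    exact hsum.congr (hae.mono fun θ h ↦ h.symm)
  · rw [arcsineMeasure, integral_map (measurable_arcsineParam c d).aemeasurable
      hmeas.aestronglyMeasurable, integral_smul_measure, integral_congr_ae hae,
      integral_add (integrable_const _) hL2,
      integral_add (hLint α) (hLint (-α)), hL0, hL0]
    simp only [integral_const, measureReal_restrict_apply_univ, Real.volume_real_Ioc, sub_zero,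
      add_zero, smul_eq_mul]
    rw [max_eq_left Real.two_pi_pos.le, ENNReal.toReal_ofReal (by positivity), ← mul_assoc,
      inv_mul_cancel₀ (by positivity), one_mul]

/-- `σ` is a probability measure on `[c, d]` for which `∫ log |s - t| dσ(t)` converges and
equals `K` for every `s` in `[c, d]`. -/
structure IsLogEquilibrium (c d : ℝ) (σ : Measure ℝ) (K : ℝ) : Prop where
  isProbabilityMeasure : IsProbabilityMeasure σ
  ae_mem : ∀ᵐ t ∂σ, t ∈ Icc c d
  integrable : ∀ s ∈ Icc c d, Integrable (fun t ↦ Real.log |s - t|) σ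
  integral_eq : ∀ s ∈ Icc c d, ∫ t, Real.log |s - t| ∂σ = K

/-! ### Measures determined by their moments -/

theorem integrable_of_continuousOn_Icc {c d : ℝ} {σ : Measure ℝ} [IsFiniteMeasure σ]
    (hσ : ∀ᵐ t ∂σ, t ∈ Icc c d) {f : ℝ → ℝ} (hf : ContinuousOn f (Icc c d)) : Integrable f σ := by
  have := hf.integrableOn_compact (μ := σ) isCompact_Icc
  rwa [IntegrableOn, Measure.restrict_eq_self_of_ae_mem hσ] at this

/-- A finite measure on a compact interval is determined by its moments, by Weierstrass
approximation. -/
theorem measure_eq_of_forall_integral_pow_eq {c d : ℝ} {σ₁ σ₂ : Measure ℝ} [IsFiniteMeasure σ₁]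
    [IsFiniteMeasure σ₂] (h₁ : ∀ᵐ t ∂σ₁, t ∈ Icc c d) (h₂ : ∀ᵐ t ∂σ₂, t ∈ Icc c d)
    (h : ∀ n : ℕ, ∫ t, t ^ n ∂σ₁ = ∫ t, t ^ n ∂σ₂) : σ₁ = σ₂ := by
  have hpoly : ∀ p : Polynomial ℝ, ∫ t, p.eval t ∂σ₁ = ∫ t, p.eval t ∂σ₂ := by
    intro p
    simp only [Polynomial.eval_eq_sum_range]
    rw [integral_finsetSum, integral_finsetSum]
    · simp only [integral_const_mul, h]
    · exact fun i _ ↦ integrable_of_continuousOn_Icc h₂ (by fun_prop)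
    · exact fun i _ ↦ integrable_of_continuousOn_Icc h₁ (by fun_prop)
  refine ext_of_forall_integral_eq_of_IsFiniteMeasure fun f ↦ ?_
  set M := σ₁.real univ + σ₂.real univ with hM
  have hM0 : 0 ≤ M := by positivity
  refine eq_of_abs_sub_le_all fun ε hε ↦ ?_
  obtain ⟨p, hp⟩ := exists_polynomial_near_of_continuousOn c d f f.continuous.continuousOn
    (ε / (M + 1)) (by positivity)
  have hest : ∀ σ : Measure ℝ, IsFiniteMeasure σ → (∀ᵐ t ∂σ, t ∈ Icc c d) →
      |∫ t, f t ∂σ - ∫ t, p.eval t ∂σ| ≤ ε / (M + 1) * σ.real univ := by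
    intro σ _ hσ
    rw [← integral_sub (integrable_of_continuousOn_Icc hσ f.continuous.continuousOn)
      (integrable_of_continuousOn_Icc hσ p.continuous.continuousOn)]
    rw [← Real.norm_eq_abs]
    refine norm_integral_le_of_norm_le_const ?_
    filter_upwards [hσ] with t ht
    rw [Real.norm_eq_abs, abs_sub_comm]
    exact (hp t ht).le
  have e₁ := hest σ₁ inferInstance h₁
  have e₂ := hest σ₂ inferInstance h₂
  rw [hpoly p] at e₁
  calc |∫ t, f t ∂σ₁ - ∫ t, f t ∂σ₂|
      ≤ |∫ t, f t ∂σ₁ - ∫ t, p.eval t ∂σ₂| + |∫ t, p.eval t ∂σ₂ - ∫ t, f t ∂σ₂| :=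
        abs_sub_le _ _ _
    _ ≤ ε / (M + 1) * M := by
        rw [abs_sub_comm (∫ t, p.eval t ∂σ₂), hM, mul_add]
        exact add_le_add e₁ e₂
    _ ≤ ε := by
        rw [div_mul_eq_mul_div, div_le_iff₀ (by positivity)]
        nlinarith

/-- `-∫ log (1 - w t) dσ(t) = ∑ mₙ wⁿ / n` with the moments `mₙ` of `σ`; the coefficient for `n = 0`
is `m₀ / 0 = 0`, as it should be. -/
theorem hasFPowerSeriesAt_integral_log_one_sub_mul {σ : Measure ℝ} [IsFiniteMeasure σ]
    (hσ : ∀ᵐ t ∂σ, t ∈ Icc (0 : ℝ) 1) :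
    HasFPowerSeriesAt (fun w ↦ -∫ t, Real.log (1 - w * t) ∂σ)
      (FormalMultilinearSeries.ofScalars ℝ fun n : ℕ ↦ (∫ t, t ^ n ∂σ) / n) 0 := by
  rw [hasFPowerSeriesAt_iff]
  filter_upwards [Metric.ball_mem_nhds (0 : ℝ) one_pos] with w hw
  rw [mem_ball_zero_iff, Real.norm_eq_abs] at hw
  simp only [FormalMultilinearSeries.coeff_ofScalars, smul_eq_mul, zero_add]
  rw [← hasSum_nat_add_iff' 1]
  have hlt : ∀ t ∈ Icc (0 : ℝ) 1, |w * t| ≤ |w| := fun t ht ↦ by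
    rw [abs_mul, abs_of_nonneg ht.1]
    exact mul_le_of_le_one_right (abs_nonneg w) ht.2
  have hgeom : Summable fun n : ℕ ↦ |w| ^ (n + 1) := by
    simpa [pow_succ] using (summable_geometric_of_lt_one (abs_nonneg w) hw).mul_right |w|
  have key := hasSum_integral_of_dominated_convergence (μ := σ)
    (F := fun (n : ℕ) t ↦ (w * t) ^ (n + 1) / ((n : ℝ) + 1)) (f := fun t ↦ -Real.log (1 - w * t))
    (fun n _ ↦ |w| ^ (n + 1)) (fun n ↦ by fun_prop) (fun n ↦ ?_)
    (Eventually.of_forall fun _ ↦ hgeom)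
    (integrable_const _) ?_
  · rw [integral_neg] at key
    convert key using 2 with n
    · simp only [mul_pow]
      rw [integral_div, integral_const_mul]
      push_cast
      ring
    · simp
  · filter_upwards [hσ] with t ht
    rw [norm_div, norm_pow, Real.norm_eq_abs, Real.norm_of_nonneg (by positivity : (0 : ℝ) ≤ n + 1)]
    refine (div_le_self (by positivity) (by linarith [n.cast_nonneg (α := ℝ)])).trans ?_
    exact pow_le_pow_left₀ (abs_nonneg _) (hlt t ht) _
  · filter_upwards [hσ] with t ht
    exact Real.hasSum_pow_div_log_of_abs_lt_one ((hlt t ht).trans_lt hw)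

theorem measure_eq_of_forall_integral_log_one_sub_mul_eq {σ₁ σ₂ : Measure ℝ}
    [IsProbabilityMeasure σ₁] [IsProbabilityMeasure σ₂] (h₁ : ∀ᵐ t ∂σ₁, t ∈ Icc (0 : ℝ) 1)
    (h₂ : ∀ᵐ t ∂σ₂, t ∈ Icc (0 : ℝ) 1)
    (h : ∀ w : ℝ, |w| < 1 → ∫ t, Real.log (1 - w * t) ∂σ₁ = ∫ t, Real.log (1 - w * t) ∂σ₂) :
    σ₁ = σ₂ := by
  have hser := HasFPowerSeriesAt.eq_formalMultilinearSeries_of_eventually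
    (hasFPowerSeriesAt_integral_log_one_sub_mul h₁)
    (hasFPowerSeriesAt_integral_log_one_sub_mul h₂) (by
      filter_upwards [Metric.ball_mem_nhds (0 : ℝ) one_pos] with w hw
      rw [mem_ball_zero_iff, Real.norm_eq_abs] at hw
      rw [h w hw])
  refine measure_eq_of_forall_integral_pow_eq h₁ h₂ fun n ↦ ?_
  rcases Nat.eq_zero_or_pos n with rfl | hn
  · simp
  · have := congrArg (fun p ↦ FormalMultilinearSeries.coeff p n) hser
    simp only [FormalMultilinearSeries.coeff_ofScalars] at this
    have hn' : (n : ℝ) ≠ 0 := by positivity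
    rwa [div_left_inj' hn'] at this

/-! ### Uniqueness of the measure with constant logarithmic potential -/

/-- The integral of `log (1 - w t)` is determined, up to the constant `K`, by the property of having
constant potential `K`: it arises by integrating that potential against an arcsine distribution
transported by the Möbius map `y ↦ y / (1 + w y)`. -/
theorem exists_integral_log_one_sub_mul_eq {c d : ℝ} (hc : 0 ≤ c) (hcd : c < d) (hd : d ≤ 1)
    {w : ℝ} (hw : |w| < 1) :
    ∃ C : ℝ, ∀ σ K, IsLogEquilibrium c d σ K → ∫ t, Real.log (1 - w * t) ∂σ = K - C := by
  have hpos : ∀ t ∈ Icc c d, 0 < 1 - w * t := fun t ht ↦ by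
    have h0 : 0 ≤ t := hc.trans ht.1
    have : |w * t| < 1 := by
      rw [abs_mul, abs_of_nonneg h0]
      exact mul_lt_one_of_nonneg_of_lt_one_left (abs_nonneg w) hw (ht.2.trans hd)
    linarith [(abs_lt.1 this).2]
  have hc' := hpos c ⟨le_rfl, hcd.le⟩
  have hd' := hpos d ⟨hcd.le, le_rfl⟩
  set c' := c / (1 - w * c) with hc'def
  set d' := d / (1 - w * d) with hd'def
  have hcd' : c' < d' := by
    rw [div_lt_div_iff₀ hc' hd']
    linarith
  have hypos : ∀ y ∈ Icc c' d', 0 < 1 + w * y := fun y hy ↦ by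
    have e1 : 0 < 1 + w * c' := by
      have : 1 + w * c' = 1 / (1 - w * c) := by rw [hc'def]; field_simp; ring
      rw [this]; positivity
    have e2 : 0 < 1 + w * d' := by
      have : 1 + w * d' = 1 / (1 - w * d) := by rw [hd'def]; field_simp; ring
      rw [this]; positivity
    rcases le_total 0 w with h | h
    · linarith [mul_le_mul_of_nonneg_left hy.1 h]
    · linarith [mul_le_mul_of_nonpos_left hy.2 h]
  have hmem : ∀ y ∈ Icc c' d', y / (1 + w * y) ∈ Icc c d := fun y hy ↦ by
    have h1 := hypos y hy
    have h2 := hy.1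
    have h3 := hy.2
    rw [hc'def, div_le_iff₀ hc'] at h2
    rw [hd'def, le_div_iff₀ hd'] at h3
    exact ⟨by rw [le_div_iff₀ h1]; linarith, by rw [div_le_iff₀ h1]; linarith⟩
  set A := arcsineMeasure c' d' with hA
  have hAmem : ∀ᵐ y ∂A, y ∈ Icc c' d' := ae_arcsineMeasure_mem_Icc hcd'
  have hlogA : Integrable (fun y ↦ Real.log (1 + w * y)) A :=
    integrable_of_continuousOn_Icc hAmem
      (ContinuousOn.log (by fun_prop) fun y hy ↦ (hypos y hy).ne')
  set κ := Real.log ((d' - c') / 4)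
  set C := κ - ∫ y, Real.log (1 + w * y) ∂A with hC
  have hA_eq : ∀ t ∈ Icc c d,
      ∫ y, Real.log |y / (1 + w * y) - t| ∂A = C + Real.log (1 - w * t) := by
    intro t ht
    have htp := hpos t ht
    have hmt : t / (1 - w * t) ∈ Icc c' d' := by
      constructor
      · rw [hc'def, div_le_div_iff₀ hc' htp]; linarith [ht.1]
      · rw [hd'def, div_le_div_iff₀ htp hd']; linarith [ht.2]
    obtain ⟨hi, he⟩ := integrable_and_integral_log_arcsineMeasure hcd' hmt
    have hne : ∀ᵐ y ∂A, y ≠ t / (1 - w * t) := by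
      rw [ae_iff]
      simpa using arcsineMeasure_singleton hcd' (t / (1 - w * t))
    have hae : ∀ᵐ y ∂A, Real.log |y / (1 + w * y) - t| =
        Real.log |t / (1 - w * t) - y| - Real.log (1 + w * y) + Real.log (1 - w * t) := by
      filter_upwards [hAmem, hne] with y hy hyt
      have hyp := hypos y hy
      have : y / (1 + w * y) - t = -((t / (1 - w * t) - y) * (1 - w * t) / (1 + w * y)) := by
        rw [sub_mul, div_mul_cancel₀ _ htp.ne', ← neg_div, eq_div_iff hyp.ne', sub_mul,
          div_mul_cancel₀ _ hyp.ne']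
        ring
      rw [this, abs_neg, abs_div, abs_mul, abs_of_pos htp, abs_of_pos hyp,
        Real.log_div (mul_ne_zero (abs_ne_zero.2 (sub_ne_zero.2 hyt.symm)) htp.ne') hyp.ne',
        Real.log_mul (abs_ne_zero.2 (sub_ne_zero.2 hyt.symm)) htp.ne']
      ring
    have hi' : Integrable
        (fun y ↦ Real.log |t / (1 - w * t) - y| - Real.log (1 + w * y)) A := hi.sub hlogA
    rw [integral_congr_ae hae, integral_add hi' (integrable_const _), integral_sub hi hlogA, he]
    simp [hC, κ, hA]
  refine ⟨C, fun σ K hσ ↦ ?_⟩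
  have := hσ.isProbabilityMeasure
  have hmeas : Measurable (Function.uncurry fun y t : ℝ ↦ Real.log |y / (1 + w * y) - t|) := by
    unfold Function.uncurry
    fun_prop
  have hint : Integrable (Function.uncurry fun y t : ℝ ↦ Real.log |y / (1 + w * y) - t|)
      (A.prod σ) := by
    rw [integrable_prod_iff hmeas.aestronglyMeasurable]
    constructor
    · filter_upwards [hAmem] with y hy
      exact hσ.integrable _ (hmem y hy)
    · refine (integrable_const (-K)).congr ?_
      filter_upwards [hAmem] with y hy
      have hs := hmem y hy
      rw [← hσ.integral_eq _ hs, ← integral_neg]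
      refine integral_congr_ae ?_
      filter_upwards [hσ.ae_mem] with t ht
      -- The length of `[c, d]` is at most one, so the logarithm has constant sign.
      have habs : |y / (1 + w * y) - t| ≤ 1 := by
        rw [abs_le]
        constructor <;> linarith [hs.1, hs.2, ht.1, ht.2]
      simp only [Function.uncurry, Real.norm_eq_abs]
      rw [abs_of_nonpos (Real.log_nonpos (abs_nonneg _) habs)]
  have hswap := integral_integral_swap hint
  have hleft : ∫ y, ∫ t, Real.log |y / (1 + w * y) - t| ∂σ ∂A = K := by
    rw [integral_congr_ae (g := fun _ ↦ K)]
    · simp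
    · filter_upwards [hAmem] with y hy
      exact hσ.integral_eq _ (hmem y hy)
  have hlogσ : Integrable (fun t ↦ Real.log (1 - w * t)) σ :=
    integrable_of_continuousOn_Icc hσ.ae_mem
      (ContinuousOn.log (by fun_prop) fun t ht ↦ (hpos t ht).ne')
  rw [hleft, integral_congr_ae (hσ.ae_mem.mono fun t ht ↦ hA_eq t ht),
    integral_add (integrable_const _) hlogσ] at hswap
  simp at hswap
  linarith

theorem IsLogEquilibrium.unique {c d : ℝ} (hc : 0 ≤ c) (hcd : c < d) (hd : d ≤ 1)
    {σ₁ σ₂ : Measure ℝ} {K₁ K₂ : ℝ} (h₁ : IsLogEquilibrium c d σ₁ K₁)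
    (h₂ : IsLogEquilibrium c d σ₂ K₂) : σ₁ = σ₂ := by
  have := h₁.isProbabilityMeasure
  have := h₂.isProbabilityMeasure
  have hsub : Icc c d ⊆ Icc (0 : ℝ) 1 := Icc_subset_Icc hc hd
  -- The case `w = 0` identifies the two constants.
  have hK : K₁ = K₂ := by
    obtain ⟨C, hC⟩ := exists_integral_log_one_sub_mul_eq hc hcd hd (w := 0) (by simp)
    have e₁ := hC _ _ h₁
    have e₂ := hC _ _ h₂
    simp at e₁ e₂
    linarith
  subst hK
  refine measure_eq_of_forall_integral_log_one_sub_mul_eq (h₁.ae_mem.mono fun t ht ↦ hsub ht)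
    (h₂.ae_mem.mono fun t ht ↦ hsub ht) fun w hw ↦ ?_
  obtain ⟨C, hC⟩ := exists_integral_log_one_sub_mul_eq hc hcd hd hw
  rw [hC _ _ h₁, hC _ _ h₂]

/-! ### Integrals of extended real kernels -/

section extIntegral

variable {α : Type*} [MeasurableSpace α] {μ : Measure α}

theorem lintegral_toENNReal_eq {f : α → EReal} {r : α → ℝ} (hf : ∀ᵐ x ∂μ, f x = (r x : EReal)) :
    ∫⁻ x, (f x).toENNReal ∂μ = ∫⁻ x, ENNReal.ofReal (r x) ∂μ := by
  refine lintegral_congr_ae ?_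
  filter_upwards [hf] with x hx
  rw [hx, EReal.toENNReal_of_ne_top (EReal.coe_ne_top _), EReal.toReal_coe]

theorem lintegral_toENNReal_neg_eq {f : α → EReal} {r : α → ℝ}
    (hf : ∀ᵐ x ∂μ, f x = (r x : EReal)) :
    ∫⁻ x, (-f x).toENNReal ∂μ = ∫⁻ x, ENNReal.ofReal (-r x) ∂μ :=
  lintegral_toENNReal_eq (hf.mono fun x hx ↦ by rw [hx, EReal.coe_neg])

theorem extIntegral_eq_integral {f : α → EReal} {r : α → ℝ} (hr : Integrable r μ)
    (hf : ∀ᵐ x ∂μ, f x = (r x : EReal)) : extIntegral μ f = ((∫ x, r x ∂μ : ℝ) : EReal) := by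
  have h1 : ∫⁻ x, ENNReal.ofReal (r x) ∂μ ≠ ⊤ := hr.lintegral_lt_top.ne
  have h2 : ∫⁻ x, ENNReal.ofReal (-r x) ∂μ ≠ ⊤ := hr.neg.lintegral_lt_top.ne
  rw [extIntegral, lintegral_toENNReal_eq hf, lintegral_toENNReal_neg_eq hf,
    integral_eq_lintegral_pos_part_sub_lintegral_neg_part hr, EReal.coe_sub,
    EReal.coe_ennreal_toReal h1, EReal.coe_ennreal_toReal h2]

theorem extIntegral_ne_bot_of_nonneg {f : α → EReal} (hf : ∀ᵐ x ∂μ, 0 ≤ f x) :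
    extIntegral μ f ≠ ⊥ := by
  have h0 : ∫⁻ x, (-f x).toENNReal ∂μ = 0 := by
    rw [← lintegral_zero (μ := μ)]
    refine lintegral_congr_ae ?_
    filter_upwards [hf] with x hx
    exact EReal.toENNReal_of_nonpos ((EReal.neg_le_neg_iff.2 hx).trans_eq neg_zero)
  rw [extIntegral, h0, EReal.coe_ennreal_zero, sub_zero]
  exact EReal.coe_ennreal_ne_bot _

/-- If a kernel which is `+∞` at `x₀` and real and bounded below elsewhere has an integral
different from `+∞`, then `x₀` is not an atom and the kernel is integrable. -/
theorem measure_singleton_eq_zero_and_integrable_of_extIntegral_ne_top [MeasurableSingletonClass α]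
    [IsFiniteMeasure μ] {f : α → EReal} {r : α → ℝ} (hr : AEStronglyMeasurable r μ) {x₀ : α}
    (htop : f x₀ = ⊤) (hf : ∀ x, x ≠ x₀ → f x = (r x : EReal)) {C : ℝ}
    (hC : ∀ᵐ x ∂μ, x ≠ x₀ → -C ≤ r x) (hne : extIntegral μ f ≠ ⊤) :
    μ {x₀} = 0 ∧ Integrable r μ := by
  have hneg : ∫⁻ x, (-f x).toENNReal ∂μ ≠ ⊤ := by
    refine ne_top_of_le_ne_top (b := ∫⁻ _, ENNReal.ofReal C ∂μ) ?_ (lintegral_mono_ae ?_)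
    · rw [lintegral_const]
      exact ENNReal.mul_ne_top ENNReal.ofReal_ne_top (measure_ne_top _ _)
    · filter_upwards [hC] with x hx
      by_cases h : x = x₀
      · rw [h, htop]
        simp
      · rw [hf x h, ← EReal.coe_neg, EReal.toENNReal_of_ne_top (EReal.coe_ne_top _),
          EReal.toReal_coe]
        exact ENNReal.ofReal_le_ofReal (by linarith [hx h])
  have hpos : ∫⁻ x, (f x).toENNReal ∂μ ≠ ⊤ := by
    intro h
    apply hne
    rw [extIntegral, h, ← EReal.coe_ennreal_toReal hneg, EReal.coe_ennreal_top,
      EReal.top_sub_coe]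
  have hatom : μ {x₀} = 0 := by
    by_contra h
    have h1 := setLIntegral_le_lintegral (μ := μ) {x₀} fun x ↦ (f x).toENNReal
    rw [lintegral_singleton, htop, EReal.toENNReal_top, ENNReal.top_mul h] at h1
    exact hpos (top_le_iff.1 h1)
  refine ⟨hatom, hr, ?_⟩
  have hae : ∀ᵐ x ∂μ, f x = (r x : EReal) := by
    have : ∀ᵐ x ∂μ, x ≠ x₀ := by
      rw [ae_iff]
      simpa using hatom
    exact this.mono fun x hx ↦ hf x hx
  rw [lintegral_toENNReal_eq hae] at hpos
  rw [lintegral_toENNReal_neg_eq hae] at hneg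
  rw [hasFiniteIntegral_iff_norm]
  refine lt_of_le_of_lt (b := ∫⁻ x, ENNReal.ofReal (r x) ∂μ + ∫⁻ x, ENNReal.ofReal (-r x) ∂μ) ?_
    (ENNReal.add_lt_top.2 ⟨hpos.lt_top, hneg.lt_top⟩)
  rw [← lintegral_add_left' hr.aemeasurable.ennreal_ofReal]
  refine lintegral_mono fun x ↦ ?_
  rcases le_total 0 (r x) with h | h
  · rw [Real.norm_of_nonneg h]
    exact le_self_add
  · rw [Real.norm_of_nonpos h]
    exact le_add_self

end extIntegral

/-! ### Transfer by the Joukowski map -/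

/-- The inverse of the Joukowski map on `[1, ∞)`. -/
def invJoukowski (x : ℝ) : ℝ := x - √(x ^ 2 - 1)

theorem joukowski_lt_joukowski {s t : ℝ} (hs : 0 < s) (hst : s < t) (ht : t < 1) :
    joukowski t < joukowski s := by
  have ht0 := hs.trans hst
  have : joukowski s - joukowski t = (t - s) * (1 - s * t) / (2 * (s * t)) := by
    rw [joukowski, joukowski]
    field_simp
    ring
  have h1 : 0 < t - s := by linarith
  have h2 : 0 < 1 - s * t := by nlinarith
  have h3 : 0 < (t - s) * (1 - s * t) / (2 * (s * t)) := by positivity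
  linarith

theorem joukowski_injOn : InjOn joukowski (Ioo 0 1) := by
  intro s hs t ht h
  rcases lt_trichotomy s t with h1 | h1 | h1
  · exact absurd h (joukowski_lt_joukowski hs.1 h1 ht.2).ne'
  · exact h1
  · exact absurd h (joukowski_lt_joukowski ht.1 h1 hs.2).ne

theorem invJoukowski_mem_Ioo {x : ℝ} (hx : 1 < x) : invJoukowski x ∈ Ioo (0 : ℝ) 1 := by
  have h0 : 0 ≤ x ^ 2 - 1 := by nlinarith
  constructor
  · rw [invJoukowski, sub_pos, Real.sqrt_lt' (by linarith)]
    linarith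
  · rw [invJoukowski, sub_lt_comm]
    apply Real.lt_sqrt_of_sq_lt
    nlinarith

theorem joukowski_invJoukowski {x : ℝ} (hx : 1 < x) : joukowski (invJoukowski x) = x := by
  have h0 : 0 ≤ x ^ 2 - 1 := by nlinarith
  have h1 := (invJoukowski_mem_Ioo hx).1
  have h2 : (invJoukowski x)⁻¹ = x + √(x ^ 2 - 1) := by
    refine inv_eq_of_mul_eq_one_right ?_
    rw [invJoukowski]
    linear_combination -Real.sq_sqrt h0
  rw [joukowski, h2, invJoukowski]
  ring

theorem invJoukowski_joukowski {s : ℝ} (hs0 : 0 < s) (hs1 : s < 1) :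
    invJoukowski (joukowski s) = s :=
  joukowski_injOn (invJoukowski_mem_Ioo (one_lt_joukowski hs0 hs1)) ⟨hs0, hs1⟩
    (joukowski_invJoukowski (one_lt_joukowski hs0 hs1))

theorem invJoukowski_le_invJoukowski {x y : ℝ} (hx : 1 < x) (hxy : x ≤ y) :
    invJoukowski y ≤ invJoukowski x := by
  by_contra! h
  have := joukowski_lt_joukowski (invJoukowski_mem_Ioo hx).1 h
    (invJoukowski_mem_Ioo (hx.trans_le hxy)).2
  rw [joukowski_invJoukowski hx, joukowski_invJoukowski (hx.trans_le hxy)] at this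
  linarith

theorem invJoukowski_lt_invJoukowski {x y : ℝ} (hx : 1 < x) (hxy : x < y) :
    invJoukowski y < invJoukowski x := by
  refine lt_of_le_of_ne (invJoukowski_le_invJoukowski hx hxy.le) fun h ↦ hxy.ne ?_
  rw [← joukowski_invJoukowski hx, ← h, joukowski_invJoukowski (hx.trans hxy)]

theorem logKernel_joukowski {s t : ℝ} (hs0 : 0 < s) (hs1 : s < 1) (ht0 : 0 < t) (ht1 : t < 1)
    (hne : t ≠ s) : logKernel ((joukowski s : ℝ) : ℂ) ((joukowski t : ℝ) : ℂ) =
      ((Real.log 2 + Real.log s + Real.log t - Real.log |s - t| - Real.log (1 - s * t) : ℝ) :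
        EReal) := by
  have hJ : joukowski s ≠ joukowski t := fun h ↦ hne (joukowski_injOn ⟨ht0, ht1⟩ ⟨hs0, hs1⟩ h.symm)
  rw [logKernel, if_neg fun h ↦ hJ (Complex.ofReal_injective h)]
  congr 1
  have h1 : joukowski s - joukowski t = -((s - t) * (1 - s * t) / (2 * s * t)) := by
    rw [joukowski, joukowski]
    field_simp
    ring
  have h2 : 0 < 1 - s * t := by nlinarith
  have h3 : |s - t| ≠ 0 := abs_ne_zero.2 (sub_ne_zero.2 hne.symm)
  rw [← Complex.ofReal_sub, Complex.norm_real, Real.norm_eq_abs, h1, abs_neg, abs_div, abs_mul,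
    abs_of_pos h2, abs_of_pos (by positivity : 0 < 2 * s * t), one_div, Real.log_inv,
    Real.log_div (mul_ne_zero h3 h2.ne') (by positivity), Real.log_mul h3 h2.ne',
    Real.log_mul (by positivity) ht0.ne', Real.log_mul two_ne_zero hs0.ne']
  ring

theorem measurable_invJoukowski_re : Measurable fun ζ : ℂ ↦ invJoukowski ζ.re := by
  unfold invJoukowski
  fun_prop

theorem measurable_joukowski : Measurable fun t : ℝ ↦ ((joukowski t : ℝ) : ℂ) := by
  unfold joukowski
  fun_prop

section totalPotential

variable {a b : ℝ}

theorem joukowski_invJoukowski_re (ha : 1 < a) {ζ : ℂ} (hζ : ζ ∈ realInterval a b) :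
    ((joukowski (invJoukowski ζ.re) : ℝ) : ℂ) = ζ := by
  obtain ⟨x, hx, rfl⟩ := hζ
  rw [Complex.ofReal_re, joukowski_invJoukowski (ha.trans_le hx.1)]

theorem invJoukowski_re_mem_Icc (ha : 1 < a) {ζ : ℂ} (hζ : ζ ∈ realInterval a b) :
    invJoukowski ζ.re ∈ Icc (invJoukowski b) (invJoukowski a) := by
  obtain ⟨x, hx, rfl⟩ := hζ
  exact ⟨invJoukowski_le_invJoukowski (ha.trans_le hx.1) hx.2,
    invJoukowski_le_invJoukowski ha hx.1⟩

/-- The Joukowski map reverses the order on `(0, 1)`, so `[j b, j a]` is the coordinate interval of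
`[a, b]`, where `j` is `invJoukowski`. -/
theorem joukowski_mem_realInterval (ha : 1 < a) (hab : a < b) {t : ℝ}
    (ht : t ∈ Icc (invJoukowski b) (invJoukowski a)) :
    ((joukowski t : ℝ) : ℂ) ∈ realInterval a b := by
  have h0 := (invJoukowski_mem_Ioo (ha.trans hab)).1.trans_le ht.1
  have h1 := ht.2.trans_lt (invJoukowski_mem_Ioo ha).2
  refine ⟨joukowski t, ⟨?_, ?_⟩, rfl⟩
  · by_contra! h
    have := invJoukowski_lt_invJoukowski (one_lt_joukowski h0 h1) h
    rw [invJoukowski_joukowski h0 h1] at this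
    linarith [ht.2]
  · by_contra! h
    have := invJoukowski_lt_invJoukowski (ha.trans hab) h
    rw [invJoukowski_joukowski h0 h1] at this
    linarith [ht.1]

theorem ae_mem_of_mem_unitMeasures {K : Set ℂ} {μ : Measure ℂ} (h : μ ∈ unitMeasures K) :
    ∀ᵐ ζ ∂μ, ζ ∈ K := by
  rw [ae_iff]
  exact h.2

theorem Icc_invJoukowski_subset_Ioo (ha : 1 < a) (hab : a < b) :
    Icc (invJoukowski b) (invJoukowski a) ⊆ Ioo (0 : ℝ) 1 := fun _ ht ↦
  ⟨(invJoukowski_mem_Ioo (ha.trans hab)).1.trans_le ht.1,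
    ht.2.trans_lt (invJoukowski_mem_Ioo ha).2⟩

theorem integrable_comp_invJoukowski (ha : 1 < a) {μ : Measure ℂ}
    (hμ : μ ∈ unitMeasures (realInterval a b)) {f : ℝ → ℝ}
    (hf : ContinuousOn f (Icc (invJoukowski b) (invJoukowski a))) :
    Integrable (fun ζ ↦ f (invJoukowski ζ.re)) μ := by
  have : IsProbabilityMeasure μ := ⟨hμ.1⟩
  have h : Integrable f (Measure.map (fun ζ : ℂ ↦ invJoukowski ζ.re) μ) := by
    refine integrable_of_continuousOn_Icc ?_ hf
    rw [ae_map_iff (p := (· ∈ Icc (invJoukowski b) (invJoukowski a)))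
      measurable_invJoukowski_re.aemeasurable measurableSet_Icc]
    exact (ae_mem_of_mem_unitMeasures hμ).mono fun ζ hζ ↦ invJoukowski_re_mem_Icc ha hζ
  exact h.comp_measurable measurable_invJoukowski_re

/-- In the coordinate `s` the total potential is, up to a constant, `-2` times the logarithmic
potential: the terms `log (1 - s t)` and `log s` cancel. -/
theorem totalPotential_eq (ha : 1 < a) (hab : a < b) {μ : Measure ℂ}
    (hμ : μ ∈ unitMeasures (realInterval a b)) {s : ℝ}
    (hs : s ∈ Icc (invJoukowski b) (invJoukowski a))
    (hatom : μ {((joukowski s : ℝ) : ℂ)} = 0)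
    (hint : Integrable (fun ζ : ℂ ↦ Real.log |s - invJoukowski ζ.re|) μ) :
    logPotential μ (joukowski s : ℝ) + greenPotential (realInterval (-1) 1) μ (joukowski s : ℝ)
      + greenFunction (sphereCompl (realInterval (-1) 1)) ((joukowski s : ℝ) : ℂ) OnePoint.infty
      = ((Real.log 2 + ∫ ζ, Real.log (invJoukowski ζ.re) ∂μ
        - 2 * ∫ ζ, Real.log |s - invJoukowski ζ.re| ∂μ : ℝ) : EReal) := by
  have : IsProbabilityMeasure μ := ⟨hμ.1⟩
  have hIoo := Icc_invJoukowski_subset_Ioo ha hab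
  obtain ⟨hs0, hs1⟩ := hIoo hs
  have hpos : ∀ t ∈ Icc (invJoukowski b) (invJoukowski a), 0 < 1 - s * t := fun t ht ↦ by
    obtain ⟨ht0, ht1⟩ := hIoo ht
    nlinarith
  have hne : ∀ᵐ ζ ∂μ, ζ ≠ ((joukowski s : ℝ) : ℂ) := by
    rw [ae_iff]
    simpa using hatom
  have hilog : Integrable (fun ζ : ℂ ↦ Real.log (invJoukowski ζ.re)) μ :=
    integrable_comp_invJoukowski ha hμ (ContinuousOn.log (by fun_prop) fun t ht ↦ (hIoo ht).1.ne')
  have hilog' : Integrable (fun ζ : ℂ ↦ Real.log (1 - s * invJoukowski ζ.re)) μ :=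
    integrable_comp_invJoukowski (f := fun t ↦ Real.log (1 - s * t)) ha hμ
      (ContinuousOn.log (by fun_prop) fun t ht ↦ (hpos t ht).ne')
  have hV : logPotential μ (joukowski s : ℝ) = ((Real.log 2 + Real.log s
      + ∫ ζ, Real.log (invJoukowski ζ.re) ∂μ - ∫ ζ, Real.log |s - invJoukowski ζ.re| ∂μ
      - ∫ ζ, Real.log (1 - s * invJoukowski ζ.re) ∂μ : ℝ) : EReal) := by
    have h1 : Integrable (fun ζ : ℂ ↦ Real.log 2 + Real.log s + Real.log (invJoukowski ζ.re)) μ :=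
      (integrable_const _).add hilog
    have h2 : Integrable (fun ζ : ℂ ↦ Real.log 2 + Real.log s + Real.log (invJoukowski ζ.re)
      - Real.log |s - invJoukowski ζ.re|) μ := h1.sub hint
    rw [logPotential, extIntegral_eq_integral (h2.sub hilog')]
    · congr 1
      simp only [Pi.sub_apply]
      rw [integral_sub h2 hilog', integral_sub h1 hint, integral_add (integrable_const _) hilog]
      simp
    · filter_upwards [ae_mem_of_mem_unitMeasures hμ, hne] with ζ hζ hζs
      have hζ' := joukowski_invJoukowski_re ha hζ
      obtain ⟨ht0, ht1⟩ := hIoo (invJoukowski_re_mem_Icc ha hζ)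
      conv_lhs => rw [← hζ']
      exact logKernel_joukowski hs0 hs1 ht0 ht1 fun h ↦ hζs (by rw [← hζ', h])
  have hG : greenPotential (realInterval (-1) 1) μ (joukowski s : ℝ) =
      ((∫ ζ, Real.log (1 - s * invJoukowski ζ.re) ∂μ
        - ∫ ζ, Real.log |s - invJoukowski ζ.re| ∂μ : ℝ) : EReal) := by
    rw [greenPotential, extIntegral_eq_integral (hilog'.sub hint)]
    · congr 1
      simp only [Pi.sub_apply]
      rw [integral_sub hilog' hint]
    · filter_upwards [ae_mem_of_mem_unitMeasures hμ, hne] with ζ hζ hζs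
      have hζ' := joukowski_invJoukowski_re ha hζ
      obtain ⟨ht0, ht1⟩ := hIoo (invJoukowski_re_mem_Icc ha hζ)
      conv_lhs => rw [← hζ']
      refine greenFunction_joukowski_joukowski hs0 hs1 ht0 ht1 fun h ↦ hζs ?_
      rw [← hζ', h]
  rw [hV, hG, greenFunction_joukowski_infty hs0 hs1, ← EReal.coe_add, ← EReal.coe_add]
  congr 1
  ring

theorem greenFunction_nonneg (ha : 1 < a) {x ζ : ℂ} (hx : x ∈ realInterval a b)
    (hζ : ζ ∈ realInterval a b) :
    0 ≤ greenFunction (sphereCompl (realInterval (-1) 1)) (ζ : OnePoint ℂ) (x : OnePoint ℂ) := by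
  by_cases h : ζ = x
  · rw [greenFunction, if_pos (by rw [h])]
    exact le_top
  · have hab : a ≤ b := by
      obtain ⟨y, hy, -⟩ := hx
      exact hy.1.trans hy.2
    have hIoo : Icc (invJoukowski b) (invJoukowski a) ⊆ Ioo (0 : ℝ) 1 := fun _ ht ↦
      ⟨(invJoukowski_mem_Ioo (ha.trans_le hab)).1.trans_le ht.1,
        ht.2.trans_lt (invJoukowski_mem_Ioo ha).2⟩
    have hx' := joukowski_invJoukowski_re ha hx
    have hζ' := joukowski_invJoukowski_re ha hζ
    obtain ⟨hs0, hs1⟩ := hIoo (invJoukowski_re_mem_Icc ha hx)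
    obtain ⟨ht0, ht1⟩ := hIoo (invJoukowski_re_mem_Icc ha hζ)
    set s := invJoukowski x.re
    set t := invJoukowski ζ.re
    have hJ : joukowski t ≠ joukowski s := fun h' ↦ h (by rw [← hζ', h', hx'])
    have hst : s ≠ t := fun h' ↦ hJ (by rw [h'])
    rw [← hx', ← hζ', greenFunction_joukowski_joukowski hs0 hs1 ht0 ht1 hJ]
    refine EReal.coe_nonneg.2 (sub_nonneg.2 (Real.log_le_log (abs_pos.2 (sub_ne_zero.2 hst)) ?_))
    rw [abs_le]
    constructor <;> nlinarith

/-- A finite total potential at a point forces the logarithmic kernel to be integrable there: the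
Green potential is nonnegative, so the logarithmic potential cannot be `+∞`. -/
theorem not_atom_and_integrable_of_totalPotential_eq (ha : 1 < a) (hab : a < b) {μ : Measure ℂ}
    (hμ : μ ∈ unitMeasures (realInterval a b)) {γ s : ℝ}
    (hs : s ∈ Icc (invJoukowski b) (invJoukowski a))
    (h : logPotential μ (joukowski s : ℝ) + greenPotential (realInterval (-1) 1) μ (joukowski s : ℝ)
      + greenFunction (sphereCompl (realInterval (-1) 1)) ((joukowski s : ℝ) : ℂ) OnePoint.infty
      = (γ : EReal)) :
    μ {((joukowski s : ℝ) : ℂ)} = 0 ∧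
      Integrable (fun ζ : ℂ ↦ Real.log |s - invJoukowski ζ.re|) μ := by
  have : IsProbabilityMeasure μ := ⟨hμ.1⟩
  have hIoo := Icc_invJoukowski_subset_Ioo ha hab
  obtain ⟨hs0, hs1⟩ := hIoo hs
  have hx := joukowski_mem_realInterval ha hab hs
  have hpos : ∀ t ∈ Icc (invJoukowski b) (invJoukowski a), 0 < 1 - s * t := fun t ht ↦ by
    obtain ⟨ht0, ht1⟩ := hIoo ht
    nlinarith
  have hV : logPotential μ (joukowski s : ℝ) ≠ ⊤ := by
    intro hV
    have hG : greenPotential (realInterval (-1) 1) μ (joukowski s : ℝ) ≠ ⊥ :=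
      extIntegral_ne_bot_of_nonneg
        ((ae_mem_of_mem_unitMeasures hμ).mono fun ζ hζ ↦ greenFunction_nonneg ha hx hζ)
    rw [hV, EReal.top_add_of_ne_bot hG, greenFunction_joukowski_infty hs0 hs1,
      EReal.top_add_coe] at h
    exact EReal.coe_ne_top γ h.symm
  obtain ⟨hatom, hr⟩ := measure_singleton_eq_zero_and_integrable_of_extIntegral_ne_top (μ := μ)
    (f := fun ζ ↦ logKernel (joukowski s : ℝ) ζ)
    (r := fun ζ ↦ Real.log (1 / ‖((joukowski s : ℝ) : ℂ) - ζ‖))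
    (x₀ := ((joukowski s : ℝ) : ℂ)) (C := Real.log (b - a))
    (Measurable.aestronglyMeasurable (by fun_prop)) (by simp [logKernel])
    (fun ζ hζ ↦ by rw [logKernel, if_neg hζ.symm]) (by
      filter_upwards [ae_mem_of_mem_unitMeasures hμ] with ζ hζ hne
      rw [one_div, Real.log_inv, neg_le_neg_iff]
      refine Real.log_le_log (norm_pos_iff.2 (sub_ne_zero.2 hne.symm)) ?_
      obtain ⟨y, hy, rfl⟩ := hζ
      obtain ⟨x, hx, hxe⟩ := hx
      simp only at hxe
      rw [← hxe, ← Complex.ofReal_sub, Complex.norm_real, Real.norm_eq_abs, abs_le]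
      constructor <;> linarith [hx.1, hx.2, hy.1, hy.2]) hV
  refine ⟨hatom, ?_⟩
  have hne : ∀ᵐ ζ ∂μ, ζ ≠ ((joukowski s : ℝ) : ℂ) := by
    rw [ae_iff]
    simpa using hatom
  have hi : Integrable (fun ζ : ℂ ↦ Real.log 2 + Real.log s + Real.log (invJoukowski ζ.re)
      - Real.log (1 - s * invJoukowski ζ.re)) μ :=
    integrable_comp_invJoukowski
      (f := fun t ↦ Real.log 2 + Real.log s + Real.log t - Real.log (1 - s * t)) ha hμ
      ((continuousOn_const.add (ContinuousOn.log (by fun_prop) fun t ht ↦ (hIoo ht).1.ne')).sub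
        (ContinuousOn.log (by fun_prop) fun t ht ↦ (hpos t ht).ne'))
  refine (hi.sub hr).congr ?_
  filter_upwards [ae_mem_of_mem_unitMeasures hμ, hne] with ζ hζ hζs
  have hζ' := joukowski_invJoukowski_re ha hζ
  obtain ⟨ht0, ht1⟩ := hIoo (invJoukowski_re_mem_Icc ha hζ)
  have hk := logKernel_joukowski hs0 hs1 ht0 ht1 fun h ↦ hζs (by rw [← hζ', h])
  rw [hζ', logKernel, if_neg hζs.symm, EReal.coe_eq_coe_iff] at hk
  simp only [Pi.sub_apply, hk]
  ring

theorem isLogEquilibrium_map_invJoukowski (ha : 1 < a) (hab : a < b) {μ : Measure ℂ}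
    (hμ : μ ∈ unitMeasures (realInterval a b)) {γ : ℝ}
    (h : ∀ x ∈ realInterval a b, logPotential μ x + greenPotential (realInterval (-1) 1) μ x
      + greenFunction (sphereCompl (realInterval (-1) 1)) (x : OnePoint ℂ) OnePoint.infty
      = (γ : EReal)) :
    IsLogEquilibrium (invJoukowski b) (invJoukowski a)
      (Measure.map (fun ζ : ℂ ↦ invJoukowski ζ.re) μ)
      ((Real.log 2 + ∫ ζ, Real.log (invJoukowski ζ.re) ∂μ - γ) / 2) := by
  have : IsProbabilityMeasure μ := ⟨hμ.1⟩
  have hτ := measurable_invJoukowski_re.aemeasurable (μ := μ)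
  have hmeas : ∀ s : ℝ, Measurable fun t : ℝ ↦ Real.log |s - t| := fun s ↦ by fun_prop
  refine ⟨Measure.isProbabilityMeasure_map hτ, ?_, fun s hs ↦ ?_, fun s hs ↦ ?_⟩
  · rw [ae_map_iff (p := (· ∈ Icc (invJoukowski b) (invJoukowski a))) hτ measurableSet_Icc]
    exact (ae_mem_of_mem_unitMeasures hμ).mono fun ζ hζ ↦ invJoukowski_re_mem_Icc ha hζ
  · rw [integrable_map_measure (hmeas s).aestronglyMeasurable hτ]
    exact (not_atom_and_integrable_of_totalPotential_eq ha hab hμ hs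
      (h _ (joukowski_mem_realInterval ha hab hs))).2
  · have h1 := h _ (joukowski_mem_realInterval ha hab hs)
    obtain ⟨hatom, hint⟩ := not_atom_and_integrable_of_totalPotential_eq ha hab hμ hs h1
    rw [totalPotential_eq ha hab hμ hs hatom hint, EReal.coe_eq_coe_iff] at h1
    rw [integral_map hτ (hmeas s).aestronglyMeasurable]
    linarith

theorem map_joukowski_map_invJoukowski (ha : 1 < a) {μ : Measure ℂ}
    (hμ : μ ∈ unitMeasures (realInterval a b)) :
    Measure.map (fun t : ℝ ↦ ((joukowski t : ℝ) : ℂ))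
      (Measure.map (fun ζ : ℂ ↦ invJoukowski ζ.re) μ) = μ := by
  rw [Measure.map_map measurable_joukowski measurable_invJoukowski_re]
  conv_rhs => rw [← Measure.map_id (μ := μ)]
  exact Measure.map_congr
    ((ae_mem_of_mem_unitMeasures hμ).mono fun ζ hζ ↦ joukowski_invJoukowski_re ha hζ)

theorem exists_unitMeasure_totalPotential_eq (ha : 1 < a) (hab : a < b) :
    ∃ μ : Measure ℂ, μ ∈ unitMeasures (realInterval a b) ∧ ∃ γ : ℝ, ∀ x ∈ realInterval a b,
      logPotential μ x + greenPotential (realInterval (-1) 1) μ x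
        + greenFunction (sphereCompl (realInterval (-1) 1)) (x : OnePoint ℂ) OnePoint.infty
        = (γ : EReal) := by
  have hcd : invJoukowski b < invJoukowski a := invJoukowski_lt_invJoukowski ha hab
  have hIoo := Icc_invJoukowski_subset_Ioo ha hab
  set A := arcsineMeasure (invJoukowski b) (invJoukowski a) with hA
  have hAmem : ∀ᵐ t ∂A, t ∈ Icc (invJoukowski b) (invJoukowski a) := ae_arcsineMeasure_mem_Icc hcd
  have hJ := measurable_joukowski.aemeasurable (μ := A)
  set μ := Measure.map (fun t : ℝ ↦ ((joukowski t : ℝ) : ℂ)) A with hμdef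
  have hK : MeasurableSet (realInterval a b) := (isCompact_realInterval a b).measurableSet
  have hμ : μ ∈ unitMeasures (realInterval a b) := by
    constructor
    · rw [hμdef, Measure.map_apply measurable_joukowski MeasurableSet.univ, preimage_univ,
        measure_univ]
    · rw [hμdef, Measure.map_apply measurable_joukowski hK.compl]
      exact measure_mono_null (fun t ht ht' ↦ ht (joukowski_mem_realInterval ha hab ht'))
        (ae_iff.1 hAmem)
  refine ⟨μ, hμ, Real.log 2 + ∫ ζ, Real.log (invJoukowski ζ.re) ∂μ
    - 2 * Real.log ((invJoukowski a - invJoukowski b) / 4), fun x hx ↦ ?_⟩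
  set s := invJoukowski x.re
  have hs : s ∈ Icc (invJoukowski b) (invJoukowski a) := invJoukowski_re_mem_Icc ha hx
  have hxs : ((joukowski s : ℝ) : ℂ) = x := joukowski_invJoukowski_re ha hx
  obtain ⟨hi, he⟩ := integrable_and_integral_log_arcsineMeasure hcd hs
  have hatom : μ {((joukowski s : ℝ) : ℂ)} = 0 := by
    rw [hμdef, Measure.map_apply measurable_joukowski (measurableSet_singleton _)]
    refine measure_mono_null (t := {s} ∪ {t | t ∉ Icc (invJoukowski b) (invJoukowski a)})
      (fun t ht ↦ ?_) (measure_union_null (arcsineMeasure_singleton hcd s) (ae_iff.1 hAmem))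
    by_cases htm : t ∈ Icc (invJoukowski b) (invJoukowski a)
    · exact Or.inl (joukowski_injOn (hIoo htm) (hIoo hs) (Complex.ofReal_injective ht))
    · exact Or.inr htm
  have hmeas : Measurable fun ζ : ℂ ↦ Real.log |s - invJoukowski ζ.re| :=
    Real.measurable_log.comp ((measurable_const.sub measurable_invJoukowski_re).abs)
  have hcomp : ∀ᵐ t ∂A, Real.log |s - invJoukowski ((joukowski t : ℝ) : ℂ).re|
      = Real.log |s - t| := by
    filter_upwards [hAmem] with t ht
    rw [Complex.ofReal_re, invJoukowski_joukowski (hIoo ht).1 (hIoo ht).2]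
  have hint : Integrable (fun ζ : ℂ ↦ Real.log |s - invJoukowski ζ.re|) μ := by
    rw [hμdef, integrable_map_measure hmeas.aestronglyMeasurable hJ]
    exact hi.congr (hcomp.mono fun t ht ↦ ht.symm)
  have hval : ∫ ζ, Real.log |s - invJoukowski ζ.re| ∂μ
      = Real.log ((invJoukowski a - invJoukowski b) / 4) := by
    rw [hμdef, integral_map hJ hmeas.aestronglyMeasurable, integral_congr_ae hcomp, he]
  rw [← hxs, totalPotential_eq ha hab hμ hs hatom hint, hval]

end totalPotential

end

theorem lemma1 (a b : ℝ) (ha : 1 < a) (hab : a < b) :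
    ∃! lam : Measure ℂ, lam ∈ unitMeasures (realInterval a b) ∧
      ∃ γ : ℝ, ∀ x ∈ realInterval a b,
        logPotential lam x + greenPotential (realInterval (-1) 1) lam x
          + greenFunction (sphereCompl (realInterval (-1) 1)) (x : OnePoint ℂ) OnePoint.infty
          = (γ : EReal) := by
  refine existsUnique_of_exists_of_unique (exists_unitMeasure_totalPotential_eq ha hab) ?_
  rintro μ₁ μ₂ ⟨hμ₁, γ₁, h₁⟩ ⟨hμ₂, γ₂, h₂⟩
  have h := (isLogEquilibrium_map_invJoukowski ha hab hμ₁ h₁).unique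
    (invJoukowski_mem_Ioo (ha.trans hab)).1.le (invJoukowski_lt_invJoukowski ha hab)
    (invJoukowski_mem_Ioo ha).2.le (isLogEquilibrium_map_invJoukowski ha hab hμ₂ h₂)
  rw [← map_joukowski_map_invJoukowski ha hμ₁, h, map_joukowski_map_invJoukowski ha hμ₂]
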